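/- Let $e\in\{2,3,4\}$, $d\ge 1$ and $N=(d-1)(e-1)$. The vanishing cycles of $y^e+x^d$ are the join cycles $\delta_i^j$ ($1\le i\le e-1$, $1\le j\le d-1$), which form a basis of the first homology of a regular fibre; $i$ is the row and $j$ the column in the Dynkin diagram. Their intersection form $\langle\cdot,\cdot\rangle$ is the skew-symmetric form given by the intersection formula for join cycles: - $\langle\delta_i^j,\delta_i^{j'}\rangle=1$ if $|j-j'|=1$ and $j$ is odd; - $\langle\delta_i^j,\delta_{i'}^j\rangle=1$ if $|i-i'|=1$ and $i$ is odd; - $\langle\delta_{i'}^{j'},\delta_i^j\rangle=1$ if $|i-i'|=|j-j'|=1$ and $i,j$ are odd, $i',j'$ are even; - all pairings that do not follow from these by skew-symmetry are $0$. Let $\Psi_e$ be the $N\times N$ matrix whose entry in row $\delta$ and column $\delta'$ is $\langle\delta',\delta\rangle$, and let $M_e=I_N-\Psi_e$ be the monodromy matrix attached to this diagram by the Picard–Lefschetz formula $v\mapsto v-\sum_{\delta}\langle v,\delta\rangle\delta$, the sum being over all vanishing cycles. Let $K$ be a field of characteristic $0$ (for instance $\mathbb Q$ or $\mathbb R$),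 and let $\mathrm{Mon}(\delta_i^j)\subseteq K^N$ be the subspace spanned by the vectors $M_e^l\,\delta_i^j$, $0\le l\le N-1$. Write $r=\gcd(d,j)$. Then: 1. ($e=2$, every $d\ge1$.) The set of eigenvalues of $M_2$ is $\{1+2\sqrt{-1}\cos(k\pi/d) : 1\le k\le d-1\}$, and the vanishing cycles in $\mathrm{Mon}(\delta_1^j)$ are exactly the $\delta_1^l$ with $l=rn$, $n=1,\dots,\frac dr-1$. 2. ($e=3$.) If $d\le100$ and $3\nmid d$, then for $i=1,2$ the vanishing cycles in $\mathrm{Mon}(\delta_i^j)$ are exactly the $\delta_m^l$ with $m\in\{1,2\}$ and $l=rn$, $n=1,\dots,\frac dr-1$. If $3\mid d$, then $M_3$ has fewer than $2(d-1)$ distinct complex eigenvalues. 3. ($e=4$.) If $d\le100$ and $4\nmid d$, then for $i=1,3$ the vanishing cycles in $\mathrm{Mon}(\delta_i^j)$ are exactly the $\delta_m^l$ with $m\in\{1,2,3\}$ and $l=rn$, $n=1,\dots,\frac dr-1$, while those in $\mathrm{Mon}(\delta_2^j)$ are exactly the $\delta_2^l$ with $l=rn$, $n=1,\dots,\frac dr-1$.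 If $4\mid d$, then $M_4$ has fewer than $3(d-1)$ distinct complex eigenvalues. -/

import Mathlib

/-- The vanishing cycles `δ_i^j` of `y^e + x^d`: pairs `(i, j)` consisting of the row `i` with
`1 ≤ i < e` and the column `j` with `1 ≤ j < d` of the Dynkin diagram. They are a basis of the
first homology of a regular fibre. -/
abbrev VanCycle (e d : ℕ) : Type := ↥(Finset.Ico 1 e) × ↥(Finset.Ico 1 d)

/-- The row `i` of `δ_i^j`. -/
def VanCycle.row {e d : ℕ} (δ : VanCycle e d) : ℕ := δ.1

/-- The column `j` of `δ_i^j`. -/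
def VanCycle.col {e d : ℕ} (δ : VanCycle e d) : ℕ := δ.2

/-- Intersection number of the `0`-dimensional vanishing cycles at the positions `a` and `b` of the
`0`-dimensional Dynkin diagram of a polynomial in one variable with real critical points: the
diagram is a path, a `0`-cycle (a difference of two points) has self-intersection `2`, and
neighbours have intersection number `-1`. -/
def zeroIntersection (a b : ℕ) : ℤ :=
  if a = b then 2 else if a + 1 = b ∨ b + 1 = a then -1 else 0

/-- Index, in the enumeration by the distinguished system of paths, of the `0`-dimensional vanishing
cycle at position `k` in the `0`-dimensional Dynkin diagram
`σ_{l+1} - σ_1 - σ_{l+2} - σ_2 - σ_{l+3} - ⋯` of a polynomial of degree `n`, with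
`l = ⌊(n-1)/2⌋`. -/
def enumIndex (n k : ℕ) : ℕ := if Even k then k / 2 else (n - 1) / 2 + (k + 1) / 2

/-- The intersection number `⟨δ, δ'⟩` of two vanishing cycles, which are the join cycles
`δ = γ_p * σ_q` and `δ' = γ_p' * σ_q'`. -/
def intersectionNumber (e d : ℕ) (δ δ' : VanCycle e d) : ℤ :=
  let p : ℤ := enumIndex e δ.row
  let p' : ℤ := enumIndex e δ'.row
  let q : ℤ := enumIndex d δ.col
  let q' : ℤ := enumIndex d δ'.col
  if p = p' ∧ q ≠ q' then (q' - q).sign * zeroIntersection δ.col δ'.col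
  else if q = q' ∧ p ≠ p' then (p' - p).sign * zeroIntersection δ.row δ'.row
  else if 0 < (p' - p) * (q' - q) then
    (p' - p).sign * zeroIntersection δ.row δ'.row * zeroIntersection δ.col δ'.col
  else 0

/-- The matrix `Ψ_e`. The entry in row `δ` and column `δ'` is `⟨δ', δ⟩`, so that the column of `δ'`
holds the coordinates of `∑ δ, ⟨δ', δ⟩ δ`. -/
def intersectionMatrix (e d : ℕ) : Matrix (VanCycle e d) (VanCycle e d) ℤ :=
  Matrix.of fun δ δ' => intersectionNumber e d δ' δ

/-- The monodromy matrix `M_e = I - Ψ_e` attached to the Dynkin diagram of `y^e + x^d`, with entries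
in `K`: its action on column vectors is the Picard-Lefschetz formula `v ↦ v - ∑ δ, ⟨v, δ⟩ δ`, the
sum running over all vanishing cycles since there is only one critical value. -/
def monodromyMatrix (K : Type*) [Field K] (e d : ℕ) : Matrix (VanCycle e d) (VanCycle e d) K :=
  1 - (intersectionMatrix e d).map (Int.cast : ℤ → K)

/-- The coordinate vector of a vanishing cycle in the basis of all vanishing cycles. -/
def cycleVec (K : Type*) [Field K] {e d : ℕ} (δ : VanCycle e d) : VanCycle e d → K :=
  Pi.single δ 1

/-- `Mon(δ)`: the subspace spanned by the orbit of `δ` under the monodromy, i.e. the Krylov space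
spanned by the vectors `M_e ^ l δ` for `0 ≤ l ≤ N - 1`, where `N = (e - 1) (d - 1)` is the number of
vanishing cycles. -/
def Mon (K : Type*) [Field K] {e d : ℕ} (δ : VanCycle e d) : Submodule K (VanCycle e d → K) :=
  Submodule.span K
    {v | ∃ l : ℕ, l < (e - 1) * (d - 1) ∧ v = (monodromyMatrix K e d ^ l).mulVec (cycleVec K δ)}

/-!
Write `M = 1 + T`. With `p`, `q` the adjacency operators of the rows and of the columns, which are
paths, and `s`, `t` the parity signs, `T = p s + q t - ½ p q (s + t)`. It commutes with `p ^ 2` and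
`q ^ 2`, and `(T ^ 2 + p ^ 2 + q ^ 2 + ½ p ^ 2 q ^ 2) ^ 2 = ¼ p ^ 2 q ^ 2 (p ^ 2 + 4) (q ^ 2 + 4)`,
which ties the eigenvalue `λ` of `T` on a common eigenvector to the eigenvalues `x`, `y` of `p ^ 2`,
`q ^ 2`; here `y = 4 cos ^ 2 (k π / d)`. For `e ∈ {3, 4}` and `e ∤ d`, an argument in the cyclotomic
field shows that `λ` determines `(x, y)`: an algebraic integer all of whose conjugates are smaller
than `1` vanishes. As `T` is skew-Hermitian, hence diagonalizable, `p ^ 2` and `q ^ 2` are then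
polynomials in `T`, so `Mon(δ)` is stable under both, and it follows that it contains `p v` and
`q v` whenever it contains a vector `v` that is homogeneous for the parities.

Continue the columns to all integers as an odd `2 d`-periodic family `F`, with
`q (F m) = F (m - 1) + F (m + 1)`. In a subspace `S` closed in this sense, applying `q` repeatedly
to `2 F m ∈ S` yields `F (m + k) + F (m - k) ∈ S` for all `k`. Hence the set of `m` with `F m ∈ S`
is stable under the reflections `n ↦ 2 m - n`; since it contains `0`, `d` and `j`, it contains all
multiples of `gcd(d, j)`. That no other columns occur is seen by pairing with the odd `2 r`-periodic
functions, `r = gcd(d, j)`, which span an invariant space. The rows are handled in the same way, and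
everything descends from `ℂ` to `K` because `M` has integer entries.

If `e ∣ d` then `p` and `q` share the eigenvalue `2 cos (π / e)`, and the corresponding product of
sines yields a two-dimensional part of the kernel of `T`.
-/

open scoped Kronecker Matrix

section Spectrum

variable {k n : Type*} [Field k] [DecidableEq k] [Fintype n] [DecidableEq n]

lemma spectrum_eq_toFinset_roots_charpoly (A : Matrix n n k) :
    spectrum k A = A.charpoly.roots.toFinset := by
  ext z
  rw [Matrix.mem_spectrum_iff_isRoot_charpoly, Finset.mem_coe, Multiset.mem_toFinset,
    Polynomial.mem_roots A.charpoly_monic.ne_zero]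

end Spectrum

section Path

variable (R : Type*) [Ring R] (n r : ℕ)

/-- The adjacency matrix of the path with vertices `1, …, n - 1`. -/
def pathAdj : Matrix (Finset.Ico 1 n) (Finset.Ico 1 n) R :=
  Matrix.of fun a b => if (a : ℕ) + 1 = b ∨ (b : ℕ) + 1 = a then 1 else 0

/-- The parity signs of the vertices of the path `1, …, n - 1`, as a diagonal matrix. -/
def pathSign : Matrix (Finset.Ico 1 n) (Finset.Ico 1 n) R :=
  Matrix.diagonal fun a => (-1) ^ (a : ℕ)

/-- The odd `2 r`-periodic function on `ℤ` with value `1` at `m` and support the classes of `m` and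
`-m` modulo `2 r`; it vanishes identically when `r ∣ m`. -/
def oddComb (m k : ℤ) : R :=
  (if (2 * r : ℤ) ∣ k - m then 1 else 0) - (if (2 * r : ℤ) ∣ k + m then 1 else 0)

/-- The image, up to sign, of the integer `m` under the folding of `ℤ` onto `{0, …, n}` by the
reflections in the multiples of `n`, as a vector on the path `1, …, n - 1`: `0` if `n ∣ m`, and `±`
a basis vector otherwise. -/
def foldVec (m : ℤ) : Finset.Ico 1 n → R := fun k => oddComb R n m (k : ℕ)

/-- The restrictions to the path `1, …, n - 1` of the odd `2 r`-periodic functions on `ℤ`. -/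
def oddPeriodic : Set (Finset.Ico 1 n → R) :=
  {w | ∃ g : ℤ → R, g.Odd ∧ Function.Periodic g (2 * r) ∧ w = fun k : Finset.Ico 1 n => g (k : ℕ)}

variable {R n r}

lemma mapMatrix_pathAdj {S : Type*} [Ring S] (f : R →+* S) :
    f.mapMatrix (pathAdj R n) = pathAdj S n := by
  ext a b
  simp [pathAdj, apply_ite f]

lemma pathAdj_two : pathAdj R 2 = 0 := by
  have h : pathAdj ℤ 2 = 0 := by decide
  rw [← mapMatrix_pathAdj (Int.castRingHom R), h, map_zero]

lemma pathAdj_three_mul_self : pathAdj R 3 * pathAdj R 3 = 1 := by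
  have h : pathAdj ℤ 3 * pathAdj ℤ 3 = 1 := by decide
  rw [← mapMatrix_pathAdj (Int.castRingHom R), ← map_mul, h, map_one]

lemma pathAdj_four_mul_self_mul_self :
    pathAdj R 4 * (pathAdj R 4 * pathAdj R 4) = 2 • pathAdj R 4 := by
  have h : pathAdj ℤ 4 * (pathAdj ℤ 4 * pathAdj ℤ 4) = 2 • pathAdj ℤ 4 := by decide
  rw [← mapMatrix_pathAdj (Int.castRingHom R), ← map_mul, ← map_mul, h, map_nsmul]

lemma pathAdj_isSymm : (pathAdj R n).IsSymm := by
  ext a b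
  simp only [Matrix.transpose_apply, pathAdj, Matrix.of_apply, or_comm]

lemma pathSign_mul_self : pathSign R n * pathSign R n = 1 := by
  rw [pathSign, Matrix.diagonal_mul_diagonal, ← Matrix.diagonal_one]
  simp [← pow_add, ← two_mul]

lemma pathSign_mul_pathAdj : pathSign R n * pathAdj R n = -(pathAdj R n * pathSign R n) := by
  ext a b
  simp only [pathSign, Matrix.diagonal_mul, Matrix.neg_apply, Matrix.mul_diagonal, pathAdj,
    Matrix.of_apply]
  split_ifs with h
  · rcases h with h | h <;> simp [← h, pow_succ]
  · simp

lemma pathAdj_mulVec {g : ℤ → R} (h0 : g 0 = 0) (hn : g n = 0) (k : Finset.Ico 1 n) :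
    (pathAdj R n *ᵥ fun a => g (a : ℕ)) k = g ((k : ℕ) - 1) + g ((k : ℕ) + 1) := by
  obtain ⟨k, hk⟩ := k
  rw [Finset.mem_Ico] at hk
  have extend : ∑ a ∈ Finset.Ico 1 n, (if k + 1 = a ∨ a + 1 = k then g a else 0) =
      ∑ a ∈ Finset.range (n + 1), if k + 1 = a ∨ a + 1 = k then g a else 0 := by
    refine Finset.sum_subset (fun a ha => by grind) fun a ha ha' => ?_
    obtain rfl | rfl : a = 0 ∨ a = n := by grind
    all_goals simp [h0, hn]
  have split (a : ℕ) : (if k + 1 = a ∨ a + 1 = k then g a else 0) =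
      (if k - 1 = a then g a else 0) + if k + 1 = a then g a else 0 := by
    split_ifs <;> first | omega | simp
  simp only [Matrix.mulVec, dotProduct, pathAdj, Matrix.of_apply, ite_mul, one_mul, zero_mul]
  rw [Finset.sum_coe_sort (Finset.Ico 1 n) fun a => if k + 1 = a ∨ a + 1 = k then g a else 0,
    extend, Finset.sum_congr rfl fun a _ => split a, Finset.sum_add_distrib, Finset.sum_ite_eq,
    Finset.sum_ite_eq, if_pos (by grind), if_pos (by grind), Nat.cast_sub hk.1]
  simp

lemma oddComb_comm (m k : ℤ) : oddComb R r m k = oddComb R r k m := by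
  simp only [oddComb, add_comm k m, dvd_sub_comm]

lemma oddComb_eq_zero {k : ℤ} (hk : (r : ℤ) ∣ k) (m : ℤ) : oddComb R r m k = 0 := by
  have h : (2 * r : ℤ) ∣ k - m ↔ (2 * r : ℤ) ∣ k + m := by
    rw [dvd_sub_comm, ← dvd_add_left (mul_dvd_mul_left 2 hk)]
    ring_nf
  simp only [oddComb, h, sub_self]

lemma oddComb_sub_add_oddComb_add (m k : ℤ) :
    oddComb R r m (k - 1) + oddComb R r m (k + 1) =
      oddComb R r (m - 1) k + oddComb R r (m + 1) k := by
  simp only [oddComb]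
  rw [show k - 1 - m = k - (m + 1) by ring, show k - 1 + m = k + (m - 1) by ring,
    show k + 1 - m = k - (m - 1) by ring, show k + 1 + m = k + (m + 1) by ring]
  abel

lemma negOnePow_mul_oddComb (m k : ℤ) :
    (k.negOnePow : R) * oddComb R r m k = (m.negOnePow : R) * oddComb R r m k := by
  by_cases h : Even (k - m)
  · rw [← Int.negOnePow_eq_iff] at h
    rw [h]
  · have h₁ : ¬ (2 * r : ℤ) ∣ k - m := fun h' => h (even_iff_two_dvd.2 (dvd_of_mul_right_dvd h'))
    have h₂ : ¬ (2 * r : ℤ) ∣ k + m := fun h' => h <| by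
      rw [Int.even_sub, ← Int.even_add]
      exact even_iff_two_dvd.2 (dvd_of_mul_right_dvd h')
    simp [oddComb, h₁, h₂]

lemma oddComb_self {m : ℤ} (hm : ¬ (r : ℤ) ∣ m) : oddComb R r m m = 1 := by
  have : ¬ (2 * r : ℤ) ∣ m + m := by
    rwa [← two_mul, Int.mul_dvd_mul_iff_left two_ne_zero]
  simp [oddComb, this]

lemma odd_oddComb (m : ℤ) : (oddComb R r m).Odd := by
  intro k
  have h : (2 * r : ℤ) ∣ -k - m ↔ (2 * r : ℤ) ∣ k + m := by
    rw [← dvd_neg, neg_sub, sub_neg_eq_add, add_comm]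
  simp only [oddComb, h, neg_add_eq_sub, dvd_sub_comm (b := m), neg_sub]

lemma periodic_oddComb (m : ℤ) : Function.Periodic (oddComb R r m) (2 * r) := by
  intro k
  simp only [oddComb, add_sub_right_comm, add_right_comm, dvd_add_self_right]

lemma foldVec_eq_zero {m : ℤ} (hm : (n : ℤ) ∣ m) : foldVec R n m = 0 := by
  ext k
  rw [foldVec, oddComb_comm, oddComb_eq_zero hm, Pi.zero_apply]

lemma pathAdj_mulVec_foldVec (m : ℤ) :
    pathAdj R n *ᵥ foldVec R n m = foldVec R n (m - 1) + foldVec R n (m + 1) := by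
  ext k
  refine (pathAdj_mulVec (oddComb_eq_zero (dvd_zero _) m)
    (oddComb_eq_zero (dvd_refl _) m) k).trans ?_
  rw [oddComb_sub_add_oddComb_add]
  rfl

lemma pathSign_mulVec_foldVec (m : ℤ) :
    pathSign R n *ᵥ foldVec R n m = (m.negOnePow : R) • foldVec R n m := by
  ext k
  rw [pathSign, Matrix.mulVec_diagonal, ← Int.cast_negOnePow_natCast, Pi.smul_apply, smul_eq_mul]
  exact negOnePow_mul_oddComb m _

lemma eq_zero_of_odd_of_periodic [NoZeroDivisors R] [CharZero R] {g : ℤ → R} (hg : g.Odd)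
    (hg' : Function.Periodic g (2 * r)) {k : ℤ} (hk : (r : ℤ) ∣ k) : g k = 0 := by
  obtain ⟨m, rfl⟩ := hk
  have h := hg'.int_mul m (-(r * m))
  rw [Int.cast_id, show -(r * m : ℤ) + m * (2 * r) = r * m by ring, hg] at h
  exact self_eq_neg.1 h

lemma pathAdj_mulVec_mem_oddPeriodic [NoZeroDivisors R] [CharZero R] (hr : r ∣ n)
    {w : Finset.Ico 1 n → R} (hw : w ∈ oddPeriodic R n r) :
    pathAdj R n *ᵥ w ∈ oddPeriodic R n r := by
  obtain ⟨g, hg, hg', rfl⟩ := hw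
  refine ⟨fun k => g (k - 1) + g (k + 1), fun k => ?_, fun k => ?_, ?_⟩
  · beta_reduce
    rw [show -k - 1 = -(k + 1) by ring, show -k + 1 = -(k - 1) by ring, hg, hg]
    abel
  · beta_reduce
    rw [add_sub_right_comm, add_right_comm, hg', hg']
  · ext k
    exact pathAdj_mulVec (eq_zero_of_odd_of_periodic hg hg' (dvd_zero _))
      (eq_zero_of_odd_of_periodic hg hg' (Int.natCast_dvd_natCast.2 hr)) k

lemma pathSign_mulVec_mem_oddPeriodic {w : Finset.Ico 1 n → R} (hw : w ∈ oddPeriodic R n r) :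
    pathSign R n *ᵥ w ∈ oddPeriodic R n r := by
  obtain ⟨g, hg, hg', rfl⟩ := hw
  refine ⟨fun k => (k.negOnePow : R) * g k, fun k => ?_, fun k => ?_, ?_⟩
  · beta_reduce
    rw [Int.negOnePow_neg, hg, mul_neg]
  · beta_reduce
    rw [Int.negOnePow_add, Int.negOnePow_even _ (even_two_mul _), mul_one, hg']
  · ext k
    rw [pathSign, Matrix.mulVec_diagonal, ← Int.cast_negOnePow_natCast]

lemma foldVec_self (m : Finset.Ico 1 n) : foldVec R n (m : ℕ) = Pi.single m 1 := by
  ext k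
  have hk := Finset.mem_Ico.1 k.2
  have hm := Finset.mem_Ico.1 m.2
  have h_add : ¬ (2 * n : ℤ) ∣ (k : ℕ) + (m : ℕ) := fun h => by
    have := Int.le_of_dvd (by omega) h
    omega
  have h_sub : (2 * n : ℤ) ∣ (k : ℕ) - (m : ℕ) ↔ k = m := by
    rw [Subtype.ext_iff]
    refine ⟨fun h => ?_, fun h => by simp [h]⟩
    have := Int.eq_zero_of_abs_lt_dvd h (by rw [abs_lt]; omega)
    omega
  simp [foldVec, oddComb, h_add, h_sub, Pi.single_apply]

lemma pathAdj_mulVec_sin {α : ℂ} (hα : Complex.sin (n * α) = 0) :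
    pathAdj ℂ n *ᵥ (fun k => Complex.sin ((k : ℕ) * α)) =
      (2 * Complex.cos α) • fun k : Finset.Ico 1 n => Complex.sin ((k : ℕ) * α) := by
  ext k
  refine (pathAdj_mulVec (g := fun k => Complex.sin (k * α)) (by simp) hα k).trans ?_
  push_cast
  rw [Pi.smul_apply, smul_eq_mul, sub_mul, add_mul, one_mul, Complex.sin_sub, Complex.sin_add]
  ring

lemma natCast_mul_pi_div_mem_Ioo {k : ℕ} (hk : k ∈ Finset.Ico 1 n) :
    k * Real.pi / n ∈ Set.Ioo 0 Real.pi := by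
  rw [Finset.mem_Ico] at hk
  have hk₀ : (0 : ℝ) < k := by exact_mod_cast hk.1
  have hkn : (k : ℝ) < n := by exact_mod_cast hk.2
  have hn : (0 : ℝ) < n := hk₀.trans hkn
  refine ⟨by positivity, (div_lt_iff₀ hn).2 ?_⟩
  rw [mul_comm]
  exact mul_lt_mul_of_pos_left hkn Real.pi_pos

variable (n) in
lemma injOn_two_mul_cos :
    Set.InjOn (fun k : ℕ => (2 * (Real.cos (k * Real.pi / n) : ℝ) : ℂ)) (Finset.Ico 1 n) := by
  intro a ha b hb hab
  have hcos := Complex.ofReal_injective (mul_left_cancel₀ two_ne_zero hab)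
  have hangle := Real.injOn_cos (Set.Ioo_subset_Icc_self (natCast_mul_pi_div_mem_Ioo ha))
    (Set.Ioo_subset_Icc_self (natCast_mul_pi_div_mem_Ioo hb)) hcos
  have hn : (n : ℝ) ≠ 0 := Nat.cast_ne_zero.2 (by grind)
  exact_mod_cast mul_right_cancel₀ Real.pi_ne_zero ((div_left_inj' hn).1 hangle)

lemma two_mul_cos_mem_spectrum_pathAdj {k : ℕ} (hk : k ∈ Finset.Ico 1 n) :
    (2 * (Real.cos (k * Real.pi / n) : ℝ) : ℂ) ∈ spectrum ℂ (pathAdj ℂ n) := by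
  have hn : (n : ℂ) ≠ 0 := Nat.cast_ne_zero.2 (by grind)
  have h_sin : Complex.sin (n * (k * Real.pi / n)) = 0 := by
    rw [mul_div_cancel₀ _ hn, Complex.sin_nat_mul_pi]
  rw [← Matrix.spectrum_toLin', ← Module.End.hasEigenvalue_iff_mem_spectrum]
  refine Module.End.hasEigenvalue_of_hasEigenvector
    (x := fun a : Finset.Ico 1 n => Complex.sin ((a : ℕ) * (k * Real.pi / n))) ⟨?_, fun h => ?_⟩
  · rw [Module.End.mem_eigenspace_iff, Matrix.toLin'_apply, pathAdj_mulVec_sin h_sin]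
    simp
  · have h_one := congrFun h ⟨1, by grind⟩
    refine (Real.sin_pos_of_mem_Ioo (natCast_mul_pi_div_mem_Ioo hk)).ne' ?_
    rw [← Complex.ofReal_inj]
    simpa using h_one

variable (n) in
lemma spectrum_pathAdj : spectrum ℂ (pathAdj ℂ n) =
    (fun k : ℕ => (2 * (Real.cos (k * Real.pi / n) : ℝ) : ℂ)) '' Finset.Ico 1 n := by
  have h_roots := spectrum_eq_toFinset_roots_charpoly (pathAdj ℂ n)
  rw [h_roots, ← Finset.coe_image, Finset.coe_inj]
  refine (Finset.eq_of_subset_of_card_le (Finset.image_subset_iff.2 fun k hk => ?_) ?_).symm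
  · rw [← Finset.mem_coe, ← h_roots]
    exact two_mul_cos_mem_spectrum_pathAdj hk
  · rw [Finset.card_image_of_injOn (injOn_two_mul_cos n)]
    refine (Multiset.toFinset_card_le _).trans ((Polynomial.card_roots' _).trans ?_)
    simp [Matrix.charpoly_natDegree_eq_dim]

end Path

/-- The relations between the adjacency operators `p` (along the rows), `q` (along the columns) and
the parity signs `s` (of the row), `t` (of the column) of a rectangular grid. -/
structure IsGrid {B : Type*} [Ring B] (p q s t : B) : Prop where
  s_mul_s : s * s = 1
  t_mul_t : t * t = 1
  t_mul_s : t * s = s * t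
  q_mul_p : q * p = p * q
  s_mul_p : s * p = -(p * s)
  s_mul_q : s * q = q * s
  t_mul_p : t * p = p * t
  t_mul_q : t * q = -(q * t)

/-- The variation `M - 1` of the monodromy `M` of the grid with adjacency operators `p`, `q` and
parity signs `s`, `t`. -/
def gridVar (K : Type*) [Field K] {B : Type*} [Ring B] [Algebra K B] (p q s t : B) : B :=
  p * s + q * t - (2⁻¹ : K) • (p * q * (s + t))

/-- The relation between the eigenvalues `l`, `x`, `y` of `-T ^ 2`, `p ^ 2`, `q ^ 2` on a common
eigenvector, where `T` is the variation of a grid with adjacency operators `p` and `q`. -/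
def EigenRelation {L : Type*} [CommRing L] (l x y : L) : Prop :=
  l ^ 2 + x ^ 2 + y ^ 2 - 2 * x * y - 2 * x * l - 2 * y * l - x * y * l = 0

lemma EigenRelation.eq_of_zero {L : Type*} [CommRing L] [IsReduced L] {l y : L}
    (h : EigenRelation l 0 y) : l = y := by
  unfold EigenRelation at h
  have h_sq : (l - y) ^ 2 = 0 := by linear_combination h
  exact sub_eq_zero.1 (eq_zero_of_pow_eq_zero h_sq)

namespace IsGrid

section Ring

variable {B C : Type*} [Ring B] [Ring C] {p q s t : B}

lemma map (h : IsGrid p q s t) (f : B →+* C) : IsGrid (f p) (f q) (f s) (f t) := by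
  constructor <;> simp only [← map_mul, ← map_neg, ← map_one f] <;> congr 1
  exacts [h.s_mul_s, h.t_mul_t, h.t_mul_s, h.q_mul_p, h.s_mul_p, h.s_mul_q, h.t_mul_p, h.t_mul_q]

lemma swap (h : IsGrid p q s t) : IsGrid q p t s :=
  ⟨h.t_mul_t, h.s_mul_s, h.t_mul_s.symm, h.q_mul_p.symm, h.t_mul_q, h.t_mul_p, h.s_mul_q, h.s_mul_p⟩

lemma neg (h : IsGrid p q s t) : IsGrid p q (-s) (-t) where
  s_mul_s := by rw [neg_mul_neg, h.s_mul_s]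
  t_mul_t := by rw [neg_mul_neg, h.t_mul_t]
  t_mul_s := by rw [neg_mul_neg, neg_mul_neg, h.t_mul_s]
  q_mul_p := h.q_mul_p
  s_mul_p := by rw [neg_mul, mul_neg, h.s_mul_p]
  s_mul_q := by rw [neg_mul, mul_neg, h.s_mul_q]
  t_mul_p := by rw [neg_mul, mul_neg, h.t_mul_p]
  t_mul_q := by rw [neg_mul, mul_neg, h.t_mul_q]

lemma commute_p_sq_s (h : IsGrid p q s t) : Commute (p * p) s := by
  have hps : p * s = -(s * p) := by rw [h.s_mul_p, neg_neg]
  rw [commute_iff_eq, mul_assoc, hps, mul_neg, ← mul_assoc, hps, neg_mul, neg_neg, mul_assoc]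

variable {K : Type*} [Field K] [Algebra K B]

lemma gridVar_swap (h : IsGrid p q s t) : gridVar K q p t s = gridVar K p q s t := by
  rw [gridVar, gridVar, h.q_mul_p, add_comm t s, add_comm (q * t)]

lemma gridVar_neg : gridVar K p q (-s) (-t) = -gridVar K p q s t := by
  simp only [gridVar, mul_neg, ← neg_add, smul_neg, neg_sub_neg, neg_sub]

lemma commute_gridVar_p_sq (h : IsGrid p q s t) : Commute (gridVar K p q s t) (p * p) := by
  have hp : Commute p (p * p) := (Commute.refl p).mul_right (Commute.refl p)
  have hq : Commute q (p * p) := Commute.mul_right h.q_mul_p h.q_mul_p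
  have hs : Commute s (p * p) := h.commute_p_sq_s.symm
  have ht : Commute t (p * p) := Commute.mul_right h.t_mul_p h.t_mul_p
  exact ((hp.mul_left hs).add_left (hq.mul_left ht)).sub_left
    (((hp.mul_left hq).mul_left (hs.add_left ht)).smul_left _)

lemma commute_gridVar_q_sq (h : IsGrid p q s t) : Commute (gridVar K p q s t) (q * q) :=
  h.gridVar_swap (K := K) ▸ h.swap.commute_gridVar_p_sq

lemma star_gridVar [StarRing B] [StarRing K] [StarModule K B] (h : IsGrid p q s t)
    (hp : IsSelfAdjoint p) (hq : IsSelfAdjoint q) (hs : IsSelfAdjoint s) (ht : IsSelfAdjoint t) :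
    star (gridVar K p q s t) = -gridVar K p q s t := by
  have h_pq : (s + t) * (q * p) = -(p * q * (s + t)) := by
    rw [add_mul, ← mul_assoc, ← mul_assoc, h.s_mul_q, h.t_mul_q, mul_assoc, h.s_mul_p, neg_mul,
      mul_assoc, h.t_mul_p, ← h.q_mul_p]
    noncomm_ring
  simp only [gridVar, star_sub, star_add, star_mul, star_smul, hp.star_eq, hq.star_eq, hs.star_eq,
    ht.star_eq, star_inv₀, star_ofNat, h.s_mul_p, h.t_mul_q, h_pq, smul_neg]
  abel

variable [CharZero K]

lemma gridVar_mul_self_add (h : IsGrid p q s t) :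
    gridVar K p q s t * gridVar K p q s t + p * p + q * q + (2⁻¹ : K) • (p * p * q * q) =
      p * q * (p + q + ((2 : K) • 1 - (2⁻¹ : K) • (p * q)) * (s * t)) := by
  have h₂ : (2 : K) ≠ 0 := two_ne_zero
  have sp (z : B) : s * (p * z) = -(p * (s * z)) := by
    rw [← mul_assoc, h.s_mul_p, neg_mul, mul_assoc]
  have sq (z : B) : s * (q * z) = q * (s * z) := by rw [← mul_assoc, h.s_mul_q, mul_assoc]
  have tp (z : B) : t * (p * z) = p * (t * z) := by rw [← mul_assoc, h.t_mul_p, mul_assoc]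
  have tq (z : B) : t * (q * z) = -(q * (t * z)) := by
    rw [← mul_assoc, h.t_mul_q, neg_mul, mul_assoc]
  have qp (z : B) : q * (p * z) = p * (q * z) := by rw [← mul_assoc, h.q_mul_p, mul_assoc]
  simp only [gridVar, mul_add, add_mul, sub_mul, mul_sub, smul_mul_assoc, mul_smul_comm, mul_assoc,
    sq, tq, sp, tp, h.q_mul_p, qp, h.s_mul_s, h.t_mul_t, h.t_mul_s, mul_neg, mul_one, one_mul,
    smul_neg, smul_add, smul_sub]
  match_scalars <;> field_simp <;> norm_num

/-- `s * t` squares to one, anticommutes with `p + q` and commutes with `p * q`; this makes the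
cross terms of the square cancel. -/
lemma sq_gridVar_mul_self_add (h : IsGrid p q s t) :
    (gridVar K p q s t * gridVar K p q s t + p * p + q * q + (2⁻¹ : K) • (p * p * q * q)) ^ 2 =
      (4⁻¹ : K) • (p * p * (q * q) * (p * p + (4 : K) • 1) * (q * q + (4 : K) • 1)) := by
  have h₂ : (2 : K) ≠ 0 := two_ne_zero
  rw [h.gridVar_mul_self_add]
  set u := s * t with hu
  have hu_sq : u * u = 1 := by
    rw [hu, mul_assoc, ← mul_assoc t, h.t_mul_s, mul_assoc s, h.t_mul_t, mul_one, h.s_mul_s]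
  have hup : u * p = -(p * u) := by
    rw [hu, mul_assoc, h.t_mul_p, ← mul_assoc, h.s_mul_p, neg_mul, mul_assoc]
  have huq : u * q = -(q * u) := by
    rw [hu, mul_assoc, h.t_mul_q, mul_neg, ← mul_assoc, h.s_mul_q, mul_assoc]
  have up (z : B) : u * (p * z) = -(p * (u * z)) := by rw [← mul_assoc, hup, neg_mul, mul_assoc]
  have uq (z : B) : u * (q * z) = -(q * (u * z)) := by rw [← mul_assoc, huq, neg_mul, mul_assoc]
  have qp (z : B) : q * (p * z) = p * (q * z) := by rw [← mul_assoc, h.q_mul_p, mul_assoc]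
  simp only [pow_two, mul_add, add_mul, sub_mul, mul_sub, smul_mul_assoc, mul_smul_comm, mul_assoc,
    up, uq, huq, qp, h.q_mul_p, hu_sq, mul_neg, neg_neg, mul_one, one_mul, smul_neg, smul_add,
    smul_sub]
  match_scalars <;> field_simp <;> norm_num

end Ring

section Module

variable {K : Type*} [Field K] {V : Type*} [AddCommGroup V] [Module K V]
  {p q s t : Module.End K V}

lemma gridVar_apply (v : V) : gridVar K p q s t v =
    p (s v) + q (t v) - (2⁻¹ : K) • p (q (s v + t v)) := by
  simp [gridVar]

lemma apply_rules (h : IsGrid p q s t) (z : V) : q (p z) = p (q z) ∧ s (p z) = -p (s z) ∧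
    s (q z) = q (s z) ∧ t (p z) = p (t z) ∧ t (q z) = -q (t z) :=
  ⟨LinearMap.congr_fun h.q_mul_p z, LinearMap.congr_fun h.s_mul_p z,
    LinearMap.congr_fun h.s_mul_q z, LinearMap.congr_fun h.t_mul_p z,
    LinearMap.congr_fun h.t_mul_q z⟩

variable [CharZero K]

lemma eigenRelation (h : IsGrid p q s t) {v : V} (hv : v ≠ 0) {l x y : K}
    (hl : gridVar K p q s t v = l • v) (hx : p (p v) = x • v) (hy : q (q v) = y • v) :
    EigenRelation (-l ^ 2) x y := by
  have e := LinearMap.congr_fun (h.sq_gridVar_mul_self_add (K := K)) v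
  simp only [pow_two, Module.End.mul_apply, LinearMap.add_apply, LinearMap.smul_apply, hl, hx, hy,
    map_smul, Module.End.one_apply, smul_smul, ← add_smul] at e
  have := smul_left_injective K hv e
  unfold EigenRelation
  linear_combination this

variable {S : Submodule K V} {x : K} (h : IsGrid p q s t) (hT : ∀ v ∈ S, gridVar K p q s t v ∈ S)
  (hp : ∀ v ∈ S, p (p v) ∈ S) (hq : ∀ v ∈ S, q (q v) ∈ S) (hpx : ∀ v, p (p (p v)) = x • p v)
  (hqx : ∀ v, q (q v) - x • v ∈ S → v ∈ S) (hqx' : ∀ v, q (q v) + (x + 4) • v ∈ S → v ∈ S)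
include h hT hp hq hpx hqx hqx'

lemma adj_mem_of_eq {v : V} (hv : v ∈ S) (hs : s v = v) (ht : t v = v) : p v ∈ S ∧ q v ∈ S := by
  have r := h.apply_rules
  have hTv : gridVar K p q s t v = p v + q v - p (q v) := by
    rw [gridVar_apply, hs, ht, map_add, map_add]
    module
  obtain ⟨D, hDS, hD⟩ : ∃ D ∈ S, D = p (p (q v)) + p (q (q v)) + (2 : K) • p (q v) := by
    refine ⟨gridVar K p q s t (gridVar K p q s t v) + p (p v) + q (q v) + p (p (q (q v))),
      S.add_mem (S.add_mem (S.add_mem (hT _ (hT _ hv)) (hp _ hv)) (hq _ hv)) (hp _ (hq _ hv)), ?_⟩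
    rw [hTv, gridVar_apply]
    simp only [map_sub, map_add, map_neg, r, hs, ht]
    module
  have hTD : gridVar K p q s t D = p (p (p (q v))) + p (q (q (q v)))
      - (2 : K) • (p (p (q v)) + p (q (q v))) := by
    rw [hD, gridVar_apply]
    simp only [map_smul, map_add, map_neg, r, hs, ht]
    module
  have hpq : p (q v) ∈ S := by
    refine hqx' _ ?_
    convert S.add_mem (hT _ hDS) (S.smul_mem 2 hDS) using 1
    rw [hTD, hD, hpx]
    simp only [r]
    module
  have h_add : p v + q v ∈ S := by
    convert S.add_mem (hT _ hv) hpq using 1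
    rw [hTv, sub_add_cancel]
  have hpv : p v ∈ S := by
    refine hqx _ ?_
    convert S.sub_mem (S.sub_mem hDS (S.smul_mem 2 hpq)) (hp _ h_add) using 1
    rw [hD, ← hpx]
    simp only [map_add, r]
    module
  exact ⟨hpv, (S.add_mem_iff_right hpv).1 h_add⟩

lemma adj_mem_of_neg {v : V} (hv : v ∈ S) (hs : s v = v) (ht : t v = -v) : p v ∈ S ∧ q v ∈ S := by
  have r := h.apply_rules
  have hTv : gridVar K p q s t v = p v - q v := by
    rw [gridVar_apply, hs, ht, add_neg_cancel, map_zero, map_zero, smul_zero, map_neg]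
    abel
  have h_sub : p v - q v ∈ S := hTv ▸ hT v hv
  obtain ⟨D, hDS, hD⟩ : ∃ D ∈ S, D = p (p (q v)) + p (q (q v)) - (2 : K) • p (q v) := by
    refine ⟨gridVar K p q s t (gridVar K p q s t v) + p (p v) + q (q v),
      S.add_mem (S.add_mem (hT _ (hT _ hv)) (hp _ hv)) (hq _ hv), ?_⟩
    rw [hTv, gridVar_apply]
    simp only [map_sub, map_add, map_neg, r, hs, ht]
    module
  have hTD : gridVar K p q s t D = p (p (p (q v))) - p (q (q (q v)))
      - p (p (q (q (p v - q v)))) + (2 : K) • (p (p (q v)) - p (q (q v))) := by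
    rw [hD, gridVar_apply]
    simp only [map_smul, map_sub, map_add, map_neg, r, hs, ht]
    module
  have hpq : p (q v) + (2 : K) • p v ∈ S := by
    refine hqx _ ?_
    convert S.neg_mem (S.add_mem (S.add_mem (hT _ hDS) (hp _ (hq _ h_sub)))
      (S.smul_mem 2 (hp _ h_sub))) using 1
    rw [hTD, smul_add, smul_comm x (2 : K) (p v), ← hpx, ← hpx]
    simp only [map_add, map_sub, map_smul, r]
    module
  have hpv : p v ∈ S := by
    refine hqx' _ ?_
    convert S.add_mem (S.add_mem hDS (hp _ h_sub)) (S.smul_mem 2 hpq) using 1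
    rw [hD, add_smul, ← hpx]
    simp only [map_sub, r]
    module
  exact ⟨hpv, (S.sub_mem_iff_right hpv).1 h_sub⟩

lemma adj_mem {v : V} (hv : v ∈ S) (hs : s v = v ∨ s v = -v)
    (ht : t v = v ∨ t v = -v) : p v ∈ S ∧ q v ∈ S := by
  have hT' : ∀ v ∈ S, gridVar K p q (-s) (-t) v ∈ S := fun v hv => by
    rw [gridVar_neg, LinearMap.neg_apply]
    exact S.neg_mem (hT v hv)
  rcases hs with hs | hs <;> rcases ht with ht | ht
  · exact h.adj_mem_of_eq hT hp hq hpx hqx hqx' hv hs ht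
  · exact h.adj_mem_of_neg hT hp hq hpx hqx hqx' hv hs ht
  · exact h.neg.adj_mem_of_neg hT' hp hq hpx hqx hqx' hv (by simp [hs]) (by simp [ht])
  · exact h.neg.adj_mem_of_eq hT' hp hq hpx hqx hqx' hv (by simp [hs]) (by simp [ht])

end Module

end IsGrid

section Grid

variable (R : Type*) [CommRing R] (e d : ℕ)

/-- The adjacency matrix of the rows of the grid of vanishing cycles. -/
def rowAdj : Matrix (VanCycle e d) (VanCycle e d) R := pathAdj R e ⊗ₖ 1

/-- The adjacency matrix of the columns of the grid of vanishing cycles. -/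
def colAdj : Matrix (VanCycle e d) (VanCycle e d) R := 1 ⊗ₖ pathAdj R d

/-- The parity signs of the rows of the grid of vanishing cycles, as a diagonal matrix. -/
def rowSign : Matrix (VanCycle e d) (VanCycle e d) R := pathSign R e ⊗ₖ 1

/-- The parity signs of the columns of the grid of vanishing cycles, as a diagonal matrix. -/
def colSign : Matrix (VanCycle e d) (VanCycle e d) R := 1 ⊗ₖ pathSign R d

lemma isGrid_matrix : IsGrid (rowAdj R e d) (colAdj R e d) (rowSign R e d) (colSign R e d) := by
  constructor <;> simp only [rowAdj, colAdj, rowSign, colSign, ← Matrix.mul_kronecker_mul, mul_one,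
    one_mul, pathSign_mul_self, Matrix.one_kronecker_one, pathSign_mul_pathAdj]
  · ext; simp
  · ext; simp

lemma rowSign_eq_diagonal : rowSign R e d = Matrix.diagonal fun δ => (-1) ^ δ.row := by
  rw [rowSign, pathSign, ← Matrix.diagonal_one, Matrix.diagonal_kronecker_diagonal]
  simp [VanCycle.row]

lemma colSign_eq_diagonal : colSign R e d = Matrix.diagonal fun δ => (-1) ^ δ.col := by
  rw [colSign, pathSign, ← Matrix.diagonal_one, Matrix.diagonal_kronecker_diagonal]
  simp [VanCycle.col]

end Grid

section IntersectionNumber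

variable {n a b : ℕ}

lemma enumIndex_inj (a b : Finset.Ico 1 n) : enumIndex n a = enumIndex n b ↔ a = b := by
  have ha := Finset.mem_Ico.1 a.2
  have hb := Finset.mem_Ico.1 b.2
  rw [enumIndex, enumIndex, Subtype.ext_iff]
  split_ifs <;> grind

lemma enumIndex_lt (ha : Even a) (han : a < n) (hb : ¬ Even b) :
    enumIndex n a < enumIndex n b := by
  rw [enumIndex, enumIndex, if_pos ha, if_neg hb]
  grind

lemma sign_mul_zeroIntersection (a b : Finset.Ico 1 n) :
    ((enumIndex n b : ℤ) - enumIndex n a).sign * zeroIntersection a b =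
      -(-1) ^ (a : ℕ) * pathAdj ℤ n a b := by
  obtain ⟨a, ha⟩ := a
  obtain ⟨b, hb⟩ := b
  rw [Finset.mem_Ico] at ha hb
  simp only [zeroIntersection, pathAdj, Matrix.of_apply]
  split_ifs with hab h h
  · omega
  · simp [hab]
  · rcases Nat.even_or_odd a with ha' | ha'
    · have := enumIndex_lt ha' ha.2 (b := b) (by grind)
      rw [Int.sign_eq_one_of_pos (by omega), ha'.neg_one_pow]
      rfl
    · have := enumIndex_lt (a := b) (b := a) (by grind) hb.2 (by grind)
      rw [Int.sign_eq_neg_one_of_neg (by omega), ha'.neg_one_pow]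
      rfl
  · simp

lemma zeroIntersection_of_ne {a b : Finset.Ico 1 n} (h : a ≠ b) :
    zeroIntersection a b = -pathAdj ℤ n a b := by
  simp only [zeroIntersection, Subtype.coe_inj, h, if_false, pathAdj, Matrix.of_apply]
  split_ifs <;> rfl

lemma two_mul_ite_sign {x y : ℤ} (hx : x ≠ 0) (hy : y ≠ 0) :
    2 * (if 0 < x * y then x.sign else 0) = x.sign + y.sign := by
  rcases hx.lt_or_gt with hx | hx <;> rcases hy.lt_or_gt with hy | hy
  · simp [mul_pos_of_neg_of_neg hx hy, Int.sign_eq_neg_one_of_neg, hx, hy]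
  · simp [(mul_neg_of_neg_of_pos hx hy).not_gt, Int.sign_eq_neg_one_of_neg, hx,
      Int.sign_eq_one_of_pos, hy]
  · simp [(mul_neg_of_pos_of_neg hx hy).not_gt, Int.sign_eq_neg_one_of_neg, hy,
      Int.sign_eq_one_of_pos, hx]
  · simp [mul_pos hx hy, Int.sign_eq_one_of_pos, hx, hy]

variable {e d : ℕ}

lemma intersectionNumber_of_row_eq (a : Finset.Ico 1 e) (b b' : Finset.Ico 1 d) :
    intersectionNumber e d (a, b) (a, b') = -(-1) ^ (b : ℕ) * pathAdj ℤ d b b' := by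
  rw [← sign_mul_zeroIntersection]
  simp only [intersectionNumber, VanCycle.row, VanCycle.col]
  split_ifs <;> simp_all

lemma intersectionNumber_of_col_eq (a a' : Finset.Ico 1 e) (b : Finset.Ico 1 d) :
    intersectionNumber e d (a, b) (a', b) = -(-1) ^ (a : ℕ) * pathAdj ℤ e a a' := by
  rw [← sign_mul_zeroIntersection]
  simp only [intersectionNumber, VanCycle.row, VanCycle.col]
  split_ifs <;> simp_all

lemma two_mul_intersectionNumber_of_ne {a a' : Finset.Ico 1 e} {b b' : Finset.Ico 1 d}
    (ha : a ≠ a') (hb : b ≠ b') : 2 * intersectionNumber e d (a, b) (a', b') =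
      ((-1) ^ (a : ℕ) + (-1) ^ (b : ℕ)) * (pathAdj ℤ e a a' * pathAdj ℤ d b b') := by
  have ha' : (enumIndex e a : ℤ) ≠ enumIndex e a' := by simpa [enumIndex_inj] using ha
  have hb' : (enumIndex d b : ℤ) ≠ enumIndex d b' := by simpa [enumIndex_inj] using hb
  have hs := two_mul_ite_sign (sub_ne_zero.2 ha'.symm) (sub_ne_zero.2 hb'.symm)
  have hsa := sign_mul_zeroIntersection a a'
  have hsb := sign_mul_zeroIntersection b b'
  rw [zeroIntersection_of_ne ha] at hsa
  rw [zeroIntersection_of_ne hb] at hsb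
  simp only [intersectionNumber, VanCycle.row, VanCycle.col, ha', hb', false_and, if_false,
    zeroIntersection_of_ne ha, zeroIntersection_of_ne hb]
  rw [mul_assoc, neg_mul_neg, ← ite_zero_mul, ← mul_assoc, hs]
  linear_combination -pathAdj ℤ d b b' * hsa - pathAdj ℤ e a a' * hsb

variable (e d) in
lemma monodromyMatrix_eq (K : Type*) [Field K] [CharZero K] : monodromyMatrix K e d =
    1 + gridVar K (rowAdj K e d) (colAdj K e d) (rowSign K e d) (colSign K e d) := by
  have cast_pathAdj {n : ℕ} (a b : Finset.Ico 1 n) :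
      ((pathAdj ℤ n b a : ℤ) : K) = pathAdj K n a b := by
    rw [pathAdj_isSymm.apply, ← mapMatrix_pathAdj (Int.castRingHom K)]
    rfl
  have pathAdj_self {n : ℕ} (a : Finset.Ico 1 n) : pathAdj K n a a = 0 := by simp [pathAdj]
  have h_pq : rowAdj K e d * colAdj K e d = pathAdj K e ⊗ₖ pathAdj K d := by
    rw [rowAdj, colAdj, ← Matrix.mul_kronecker_mul, one_mul, mul_one]
  rw [monodromyMatrix, sub_eq_add_neg, gridVar, h_pq, rowSign_eq_diagonal, colSign_eq_diagonal,
    Matrix.diagonal_add]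
  congr 1
  ext ⟨a, b⟩ ⟨a', b'⟩
  simp only [Matrix.neg_apply, Matrix.map_apply, intersectionMatrix, Matrix.of_apply,
    Matrix.sub_apply, Matrix.add_apply, Matrix.mul_diagonal, Matrix.smul_apply, smul_eq_mul,
    rowAdj, colAdj, Matrix.kronecker_apply, VanCycle.row, VanCycle.col]
  rcases eq_or_ne a a' with rfl | ha
  · rw [intersectionNumber_of_row_eq]
    push_cast
    rw [cast_pathAdj, pathAdj_self, Matrix.one_apply_eq]
    ring
  rcases eq_or_ne b b' with rfl | hb
  · rw [intersectionNumber_of_col_eq]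
    push_cast
    rw [cast_pathAdj, pathAdj_self, Matrix.one_apply_eq]
    ring
  · have h := congrArg (Int.cast : ℤ → K) (two_mul_intersectionNumber_of_ne ha.symm hb.symm)
    push_cast at h
    rw [cast_pathAdj, cast_pathAdj] at h
    rw [Matrix.one_apply_ne ha, Matrix.one_apply_ne hb]
    linear_combination -(2⁻¹ : K) * h

end IntersectionNumber

section GridTensor

variable {R ι κ : Type*} [CommRing R]

/-- The function `(a, b) ↦ u a * w b` on a grid, for functions `u` on the rows and `w` on the
columns. -/
def gridTensor (u : ι → R) (w : κ → R) : ι × κ → R := fun δ => u δ.1 * w δ.2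

variable [Fintype ι] [Fintype κ]

/-- The functions on a grid that are orthogonal to the products of the row functions in `U` with
the column functions in `W`. -/
def gridOrthogonal (U : Set (ι → R)) (W : Set (κ → R)) : Submodule R (ι × κ → R) where
  carrier := {v | ∀ u ∈ U, ∀ w ∈ W, gridTensor u w ⬝ᵥ v = 0}
  add_mem' hv hv' u hu w hw := by rw [dotProduct_add, hv u hu w hw, hv' u hu w hw, add_zero]
  zero_mem' _ _ _ _ := dotProduct_zero _
  smul_mem' c v hv u hu w hw := by rw [dotProduct_smul, hv u hu w hw, smul_zero]

lemma kronecker_mulVec_gridTensor (A : Matrix ι ι R) (B : Matrix κ κ R) (u : ι → R) (w : κ → R) :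
    (A ⊗ₖ B) *ᵥ gridTensor u w = gridTensor (A *ᵥ u) (B *ᵥ w) := by
  ext δ
  simp only [Matrix.mulVec, dotProduct, gridTensor, Matrix.kroneckerMap, Matrix.of_apply,
    Finset.sum_mul_sum, Fintype.sum_prod_type, mul_mul_mul_comm]

lemma kronecker_mulVec_mem_gridOrthogonal {A : Matrix ι ι R} {B : Matrix κ κ R} (hA : A.IsSymm)
    (hB : B.IsSymm) {U : Set (ι → R)} {W : Set (κ → R)} (hU : ∀ u ∈ U, A *ᵥ u ∈ U)
    (hW : ∀ w ∈ W, B *ᵥ w ∈ W) {v : ι × κ → R} (hv : v ∈ gridOrthogonal U W) :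
    (A ⊗ₖ B) *ᵥ v ∈ gridOrthogonal U W := by
  intro u hu w hw
  rw [Matrix.dotProduct_mulVec, ← Matrix.mulVec_transpose, ← Matrix.kroneckerMap_transpose, hA.eq,
    hB.eq, kronecker_mulVec_gridTensor]
  exact hv _ (hU u hu) _ (hW w hw)

end GridTensor

section Operators

variable (K : Type*) [Field K] (e d : ℕ)

/-- `rowAdj` as an endomorphism. -/
def rowEnd : Module.End K (VanCycle e d → K) := Matrix.toLinAlgEquiv' (rowAdj K e d)

/-- `colAdj` as an endomorphism. -/
def colEnd : Module.End K (VanCycle e d → K) := Matrix.toLinAlgEquiv' (colAdj K e d)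

/-- `rowSign` as an endomorphism. -/
def rowSignEnd : Module.End K (VanCycle e d → K) := Matrix.toLinAlgEquiv' (rowSign K e d)

/-- `colSign` as an endomorphism. -/
def colSignEnd : Module.End K (VanCycle e d → K) := Matrix.toLinAlgEquiv' (colSign K e d)

/-- The variation of the monodromy as an endomorphism. -/
def varEnd : Module.End K (VanCycle e d → K) :=
  gridVar K (rowEnd K e d) (colEnd K e d) (rowSignEnd K e d) (colSignEnd K e d)

/-- The tensor product of two folded integers: the vanishing cycles, continued to all integer
positions as odd periodic functions. -/
def latticeVec (a m : ℤ) : VanCycle e d → K := gridTensor (foldVec K e a) (foldVec K d m)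

lemma isGrid_end :
    IsGrid (rowEnd K e d) (colEnd K e d) (rowSignEnd K e d) (colSignEnd K e d) :=
  (isGrid_matrix K e d).map
    (Matrix.toLinAlgEquiv' (R := K) (n := VanCycle e d)).toAlgHom.toRingHom

variable {K e d}

lemma varEnd_eq_toLinAlgEquiv' : varEnd K e d = Matrix.toLinAlgEquiv'
    (gridVar K (rowAdj K e d) (colAdj K e d) (rowSign K e d) (colSign K e d)) := by
  simp only [varEnd, gridVar, rowEnd, colEnd, rowSignEnd, colSignEnd, map_add, map_sub, map_mul,
    map_smul]

lemma monodromyMatrix_mulVec [CharZero K] (v : VanCycle e d → K) :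
    monodromyMatrix K e d *ᵥ v = v + varEnd K e d v := by
  rw [monodromyMatrix_eq, Matrix.add_mulVec, Matrix.one_mulVec, varEnd_eq_toLinAlgEquiv',
    Matrix.toLinAlgEquiv'_apply]

section GridTensor

variable (u : Finset.Ico 1 e → K) (w : Finset.Ico 1 d → K)

lemma rowEnd_gridTensor : rowEnd K e d (gridTensor u w) = gridTensor (pathAdj K e *ᵥ u) w := by
  rw [rowEnd, Matrix.toLinAlgEquiv'_apply, rowAdj, kronecker_mulVec_gridTensor, Matrix.one_mulVec]

lemma colEnd_gridTensor : colEnd K e d (gridTensor u w) = gridTensor u (pathAdj K d *ᵥ w) := by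
  rw [colEnd, Matrix.toLinAlgEquiv'_apply, colAdj, kronecker_mulVec_gridTensor, Matrix.one_mulVec]

lemma rowSignEnd_gridTensor :
    rowSignEnd K e d (gridTensor u w) = gridTensor (pathSign K e *ᵥ u) w := by
  rw [rowSignEnd, Matrix.toLinAlgEquiv'_apply, rowSign, kronecker_mulVec_gridTensor,
    Matrix.one_mulVec]

lemma colSignEnd_gridTensor :
    colSignEnd K e d (gridTensor u w) = gridTensor u (pathSign K d *ᵥ w) := by
  rw [colSignEnd, Matrix.toLinAlgEquiv'_apply, colSign, kronecker_mulVec_gridTensor,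
    Matrix.one_mulVec]

end GridTensor

lemma rowEnd_latticeVec (a m : ℤ) : rowEnd K e d (latticeVec K e d a m) =
    latticeVec K e d (a - 1) m + latticeVec K e d (a + 1) m := by
  rw [latticeVec, rowEnd_gridTensor, pathAdj_mulVec_foldVec]
  exact funext fun _ => add_mul _ _ _

lemma colEnd_latticeVec (a m : ℤ) : colEnd K e d (latticeVec K e d a m) =
    latticeVec K e d a (m - 1) + latticeVec K e d a (m + 1) := by
  rw [latticeVec, colEnd_gridTensor, pathAdj_mulVec_foldVec]
  exact funext fun _ => mul_add _ _ _

lemma rowSignEnd_latticeVec (a m : ℤ) :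
    rowSignEnd K e d (latticeVec K e d a m) = (a.negOnePow : K) • latticeVec K e d a m := by
  rw [latticeVec, rowSignEnd_gridTensor, pathSign_mulVec_foldVec]
  exact funext fun _ => mul_assoc _ _ _

lemma colSignEnd_latticeVec (a m : ℤ) :
    colSignEnd K e d (latticeVec K e d a m) = (m.negOnePow : K) • latticeVec K e d a m := by
  rw [latticeVec, colSignEnd_gridTensor, pathSign_mulVec_foldVec]
  exact funext fun _ => mul_left_comm _ _ _

lemma latticeVec_eq_zero_of_dvd_row {a : ℤ} (ha : (e : ℤ) ∣ a) (m : ℤ) :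
    latticeVec K e d a m = 0 := by
  rw [latticeVec, foldVec_eq_zero ha]
  exact funext fun _ => zero_mul _

lemma latticeVec_eq_zero_of_dvd_col (a : ℤ) {m : ℤ} (hm : (d : ℤ) ∣ m) :
    latticeVec K e d a m = 0 := by
  rw [latticeVec, foldVec_eq_zero hm]
  exact funext fun _ => mul_zero _

lemma cycleVec_eq_latticeVec (δ : VanCycle e d) :
    cycleVec K δ = latticeVec K e d δ.row δ.col := by
  rw [latticeVec, VanCycle.row, VanCycle.col, foldVec_self, foldVec_self]
  ext δ'
  simp only [cycleVec, gridTensor, Pi.single_apply, Prod.ext_iff, ite_and, ite_mul, one_mul,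
    zero_mul]

end Operators

section Krylov

lemma matrixPow_mulVec_mem_span {K ι : Type*} [Field K] [Fintype ι] [DecidableEq ι]
    (M : Matrix ι ι K) (v : ι → K) (k : ℕ) :
    M ^ k *ᵥ v ∈ Submodule.span K {w | ∃ l < Fintype.card ι, w = M ^ l *ᵥ v} := by
  cases isEmpty_or_nonempty ι
  · rw [Subsingleton.elim (M ^ k *ᵥ v) 0]
    exact Submodule.zero_mem _
  have h_ne : M.charpoly ≠ 1 := fun h => by
    have h_deg := M.charpoly_natDegree_eq_dim
    rw [h, Polynomial.natDegree_one] at h_deg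
    exact Fintype.card_ne_zero h_deg.symm
  have h_lt := Polynomial.natDegree_modByMonic_lt (Polynomial.X ^ k) M.charpoly_monic h_ne
  rw [M.charpoly_natDegree_eq_dim] at h_lt
  rw [Matrix.pow_eq_aeval_mod_charpoly, Polynomial.aeval_eq_sum_range' h_lt, Matrix.sum_mulVec]
  refine Submodule.sum_mem _ fun l hl => ?_
  rw [Matrix.smul_mulVec]
  exact Submodule.smul_mem _ _ (Submodule.subset_span ⟨l, Finset.mem_range.1 hl, rfl⟩)

variable {K : Type*} [Field K] {e d : ℕ}

lemma pow_mulVec_mem_Mon (δ : VanCycle e d) (k : ℕ) :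
    monodromyMatrix K e d ^ k *ᵥ cycleVec K δ ∈ Mon K δ := by
  have h := matrixPow_mulVec_mem_span (monodromyMatrix K e d) (cycleVec K δ) k
  simp only [Fintype.card_prod, Fintype.card_coe, Nat.card_Ico] at h
  exact h

lemma cycleVec_mem_Mon (δ : VanCycle e d) : cycleVec K δ ∈ Mon K δ := by
  simpa using pow_mulVec_mem_Mon (K := K) δ 0

lemma Mon_le_of_mulVec_mem {δ : VanCycle e d} {S : Submodule K (VanCycle e d → K)}
    (hδ : cycleVec K δ ∈ S) (hS : ∀ v ∈ S, monodromyMatrix K e d *ᵥ v ∈ S) : Mon K δ ≤ S := by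
  rw [Mon, Submodule.span_le]
  rintro _ ⟨l, -, rfl⟩
  induction l with
  | zero => simpa using hδ
  | succ l ih =>
    rw [pow_succ', ← Matrix.mulVec_mulVec]
    exact hS _ ih

lemma varEnd_mem_Mon [CharZero K] (δ : VanCycle e d) {v : VanCycle e d → K} (hv : v ∈ Mon K δ) :
    varEnd K e d v ∈ Mon K δ := by
  suffices h : monodromyMatrix K e d *ᵥ v ∈ Mon K δ by
    rw [monodromyMatrix_mulVec] at h
    exact ((Mon K δ).add_mem_iff_right hv).1 h
  rw [Mon] at hv
  induction hv using Submodule.span_induction with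
  | mem w hw =>
    obtain ⟨l, -, rfl⟩ := hw
    rw [Matrix.mulVec_mulVec, ← pow_succ']
    exact pow_mulVec_mem_Mon δ _
  | zero => simp
  | add v w _ _ hv hw => rw [Matrix.mulVec_add]; exact Submodule.add_mem _ hv hw
  | smul c v _ hv => rw [Matrix.mulVec_smul]; exact Submodule.smul_mem _ c hv

end Krylov

section Necessity

variable {K : Type*} [Field K] {e d : ℕ}

lemma cycleVec_mem_gridOrthogonal_iff {U : Set (Finset.Ico 1 e → K)}
    {W : Set (Finset.Ico 1 d → K)} {δ : VanCycle e d} :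
    cycleVec K δ ∈ gridOrthogonal U W ↔ ∀ u ∈ U, ∀ w ∈ W, u δ.1 * w δ.2 = 0 := by
  simp [gridOrthogonal, cycleVec, gridTensor]

lemma Mon_le_gridOrthogonal [CharZero K] {U : Set (Finset.Ico 1 e → K)}
    {W : Set (Finset.Ico 1 d → K)} (hUp : ∀ u ∈ U, pathAdj K e *ᵥ u ∈ U)
    (hUs : ∀ u ∈ U, pathSign K e *ᵥ u ∈ U) (hWq : ∀ w ∈ W, pathAdj K d *ᵥ w ∈ W)
    (hWt : ∀ w ∈ W, pathSign K d *ᵥ w ∈ W) {δ : VanCycle e d}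
    (hδ : cycleVec K δ ∈ gridOrthogonal U W) : Mon K δ ≤ gridOrthogonal U W := by
  have one_mem {n : ℕ} (F : Set (Finset.Ico 1 n → K)) : ∀ u ∈ F, 1 *ᵥ u ∈ F := by simp
  have hp := @kronecker_mulVec_mem_gridOrthogonal (hA := pathAdj_isSymm) (hB := Matrix.isSymm_one)
    (hU := hUp) (hW := one_mem W)
  have hq := @kronecker_mulVec_mem_gridOrthogonal (hA := Matrix.isSymm_one) (hB := pathAdj_isSymm)
    (hU := one_mem U) (hW := hWq)
  have hs := @kronecker_mulVec_mem_gridOrthogonal (hA := Matrix.isSymm_diagonal _)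
    (hB := Matrix.isSymm_one) (hU := hUs) (hW := one_mem W)
  have ht := @kronecker_mulVec_mem_gridOrthogonal (hA := Matrix.isSymm_one)
    (hB := Matrix.isSymm_diagonal _) (hU := one_mem U) (hW := hWt)
  refine Mon_le_of_mulVec_mem hδ fun v hv => ?_
  simp only [monodromyMatrix_eq, gridVar, Matrix.add_mulVec, Matrix.sub_mulVec, Matrix.one_mulVec,
    Matrix.smul_mulVec, ← Matrix.mulVec_mulVec, Matrix.mulVec_add]
  exact add_mem hv (sub_mem (add_mem (hp (hs hv)) (hq (ht hv))) (Submodule.smul_mem _ _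
    (add_mem (hp (hq (hs hv))) (hp (hq (ht hv))))))

lemma dvd_col_of_cycleVec_mem_Mon [CharZero K] {r : ℕ} {δ δ' : VanCycle e d} (hd : r ∣ d)
    (hδ : r ∣ δ.col) (h : cycleVec K δ' ∈ Mon K δ) : r ∣ δ'.col := by
  have hle : Mon K δ ≤ gridOrthogonal Set.univ (oddPeriodic K d r) := by
    refine Mon_le_gridOrthogonal (fun _ _ => Set.mem_univ _) (fun _ _ => Set.mem_univ _)
      (fun w => pathAdj_mulVec_mem_oddPeriodic hd) (fun w => pathSign_mulVec_mem_oddPeriodic)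
      (cycleVec_mem_gridOrthogonal_iff.2 ?_)
    rintro u - _ ⟨g, hg, hg', rfl⟩
    exact mul_eq_zero_of_right _
      (eq_zero_of_odd_of_periodic hg hg' (Int.natCast_dvd_natCast.2 hδ))
  by_contra hr
  have h_zero := cycleVec_mem_gridOrthogonal_iff.1 (hle h) 1 trivial _
    ⟨_, odd_oddComb δ'.col, periodic_oddComb _, rfl⟩
  rw [← Int.natCast_dvd_natCast] at hr
  refine one_ne_zero (α := K) ?_
  rw [← oddComb_self hr, ← h_zero, Pi.one_apply, one_mul]
  rfl

lemma dvd_row_of_cycleVec_mem_Mon [CharZero K] {r : ℕ} {δ δ' : VanCycle e d} (he : r ∣ e)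
    (hδ : r ∣ δ.row) (h : cycleVec K δ' ∈ Mon K δ) : r ∣ δ'.row := by
  have hle : Mon K δ ≤ gridOrthogonal (oddPeriodic K e r) Set.univ := by
    refine Mon_le_gridOrthogonal (fun w => pathAdj_mulVec_mem_oddPeriodic he)
      (fun w => pathSign_mulVec_mem_oddPeriodic) (fun _ _ => Set.mem_univ _)
      (fun _ _ => Set.mem_univ _) (cycleVec_mem_gridOrthogonal_iff.2 ?_)
    rintro _ ⟨g, hg, hg', rfl⟩ w -
    exact mul_eq_zero_of_left
      (eq_zero_of_odd_of_periodic hg hg' (Int.natCast_dvd_natCast.2 hδ)) _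
  by_contra hr
  have h_zero := cycleVec_mem_gridOrthogonal_iff.1 (hle h) _
    ⟨_, odd_oddComb δ'.row, periodic_oddComb _, rfl⟩ 1 trivial
  rw [← Int.natCast_dvd_natCast] at hr
  refine one_ne_zero (α := K) ?_
  rw [← oddComb_self hr, ← h_zero, Pi.one_apply, mul_one]
  rfl

end Necessity

section Sufficiency

lemma exists_odd_eq_gcd_mul (a b : ℤ) :
    ∃ z, Odd z ∧ (a = Int.gcd a b * z ∨ b = Int.gcd a b * z) := by
  obtain ⟨a', ha⟩ := Int.gcd_dvd_left a b
  obtain ⟨b', hb⟩ := Int.gcd_dvd_right a b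
  rcases eq_or_ne (Int.gcd a b : ℤ) 0 with h_zero | h_ne
  · exact ⟨1, odd_one, Or.inl (ha.trans (by rw [h_zero, zero_mul, zero_mul]))⟩
  rcases Int.even_or_odd a' with h_even | h_odd
  · rcases Int.even_or_odd b' with h_even' | h_odd'
    · have h_dvd : (Int.gcd a b : ℤ) * 2 ∣ Int.gcd a b * 1 := by
        rw [mul_one]
        exact Int.dvd_coe_gcd ((mul_dvd_mul_left _ h_even.two_dvd).trans ha.symm.dvd)
          ((mul_dvd_mul_left _ h_even'.two_dvd).trans hb.symm.dvd)
      exact absurd (Int.dvd_of_mul_dvd_mul_left h_ne h_dvd) (by decide)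
    · exact ⟨b', h_odd', Or.inr hb⟩
  · exact ⟨a', h_odd, Or.inl ha⟩

lemma mem_of_gcd_dvd_of_reflection {G : Set ℤ} (hG : ∀ m ∈ G, ∀ n ∈ G, 2 * m - n ∈ G) {a b n : ℤ}
    (h0 : 0 ∈ G) (ha : a ∈ G) (hb : b ∈ G) (hn : (Int.gcd a b : ℤ) ∣ n) : n ∈ G := by
  have neg_mem {m : ℤ} (hm : m ∈ G) : -m ∈ G := by simpa using hG 0 h0 m hm
  let P : AddSubgroup ℤ :=
    { carrier := {z | ∀ m ∈ G, m + z ∈ G}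
      add_mem' := fun hz hz' m hm => by rw [← add_assoc]; exact hz' _ (hz _ hm)
      zero_mem' := fun m hm => by rwa [add_zero]
      neg_mem' := fun hz m hm => by simpa [add_comm] using neg_mem (hz _ (neg_mem hm)) }
  have two_mul_mem {m : ℤ} (hm : m ∈ G) : 2 * m ∈ P := fun n hn => by
    simpa [add_comm] using hG m hm _ (neg_mem hn)
  set r : ℤ := (Int.gcd a b : ℤ) with hr
  have hrP (z : ℤ) : 2 * r * z ∈ P := by
    rw [hr, Int.gcd_eq_gcd_ab, mul_add, add_mul]
    convert P.add_mem (P.zsmul_mem (two_mul_mem ha) (a.gcdA b * z))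
      (P.zsmul_mem (two_mul_mem hb) (a.gcdB b * z)) using 2 <;> rw [smul_eq_mul] <;> ring
  have hrG : r ∈ G := by
    obtain ⟨z, ⟨k, rfl⟩, h_eq⟩ := exists_odd_eq_gcd_mul a b
    have h_mem : r * (2 * k + 1) ∈ G := h_eq.elim (· ▸ ha) (· ▸ hb)
    convert hrP (-k) _ h_mem using 1
    ring
  obtain ⟨c, rfl⟩ := hn
  rcases Int.even_or_odd' c with ⟨k, rfl | rfl⟩
  · convert hrP k 0 h0 using 1
    ring
  · convert hrP k r hrG using 1
    ring

variable {K : Type*} [Field K]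

lemma mem_of_gcd_dvd_of_recurrence [NeZero (2 : K)] {V : Type*} [AddCommGroup V] [Module K V]
    {S : Submodule K V} {A : Module.End K V} {F : ℤ → V} (hA : ∀ m, A (F m) = F (m - 1) + F (m + 1))
    (hS : ∀ m k, F (m + k) + F (m - k) ∈ S → A (F (m + k) + F (m - k)) ∈ S) {a b n : ℤ}
    (h0 : F 0 = 0) (ha : F a = 0) (hb : F b ∈ S) (hn : (Int.gcd a b : ℤ) ∣ n) : F n ∈ S := by
  refine mem_of_gcd_dvd_of_reflection (G := {m | F m ∈ S}) ?_ (by simp [h0]) (by simp [ha]) hb hn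
  intro m hm n hn
  have add_mem_nat (k : ℕ) : F (m + k) + F (m - k) ∈ S ∧
      F (m + (k + 1 : ℕ)) + F (m - (k + 1 : ℕ)) ∈ S := by
    induction k with
    | zero =>
      have h_two : F (m + (0 : ℕ)) + F (m - (0 : ℕ)) = (2 : K) • F m := by
        simp [two_smul]
      have h := hS m (0 : ℕ) (h_two ▸ S.smul_mem 2 hm)
      rw [h_two, map_smul, S.smul_mem_iff two_ne_zero, hA, add_comm] at h
      exact ⟨h_two ▸ S.smul_mem 2 hm, by simpa using h⟩
    | succ k ih =>
      refine ⟨ih.2, ?_⟩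
      convert S.sub_mem (hS _ _ ih.2) ih.1 using 1
      rw [map_add, hA, hA]
      push_cast
      rw [show m + ((k : ℤ) + 1) - 1 = m + k by ring, show m - ((k : ℤ) + 1) + 1 = m - k by ring,
        show m + ((k : ℤ) + 1) + 1 = m + (k + 1 + 1) by ring,
        show m - ((k : ℤ) + 1) - 1 = m - (k + 1 + 1) by ring]
      abel
  have add_mem_int (k : ℤ) : F (m + k) + F (m - k) ∈ S := by
    obtain ⟨k, rfl | rfl⟩ := k.eq_nat_or_neg
    · exact (add_mem_nat k).1
    · simpa [add_comm, ← sub_eq_add_neg] using (add_mem_nat k).1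
  have h := add_mem_int (m - n)
  rw [sub_sub_cancel, S.add_mem_iff_left hn] at h
  rwa [Set.mem_ofPred_eq, two_mul, add_sub_assoc]

variable {e d : ℕ}

/-- A subspace is adjacency closed if it contains the images under the row and column adjacency
of those of its vectors that are homogeneous for the parities of the row and of the column. -/
def AdjClosed (S : Submodule K (VanCycle e d → K)) : Prop :=
  ∀ v ∈ S, rowSignEnd K e d v = v ∨ rowSignEnd K e d v = -v →
    colSignEnd K e d v = v ∨ colSignEnd K e d v = -v → rowEnd K e d v ∈ S ∧ colEnd K e d v ∈ S

lemma AdjClosed.adj_mem {S : Submodule K (VanCycle e d → K)} (hS : AdjClosed S)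
    {v : VanCycle e d → K} (hv : v ∈ S) {a m : ℤ}
    (ha : rowSignEnd K e d v = (a.negOnePow : K) • v)
    (hm : colSignEnd K e d v = (m.negOnePow : K) • v) :
    rowEnd K e d v ∈ S ∧ colEnd K e d v ∈ S := by
  refine hS v hv ?_ ?_
  · rcases Int.units_eq_one_or a.negOnePow with h | h <;> simp [ha, h]
  · rcases Int.units_eq_one_or m.negOnePow with h | h <;> simp [hm, h]

theorem AdjClosed.cycleVec_mem [NeZero (2 : K)] {S : Submodule K (VanCycle e d → K)}
    (hS : AdjClosed S) {δ δ' : VanCycle e d} (h : cycleVec K δ ∈ S)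
    (hrow : Nat.gcd e δ.row ∣ δ'.row) (hcol : Nat.gcd d δ.col ∣ δ'.col) : cycleVec K δ' ∈ S := by
  have negOnePow_add_eq (m k : ℤ) : (m + k).negOnePow = (m - k).negOnePow := by
    rw [Int.negOnePow_add, Int.negOnePow_sub]
  rw [cycleVec_eq_latticeVec] at h ⊢
  have h_col : latticeVec K e d δ.row δ'.col ∈ S := by
    refine mem_of_gcd_dvd_of_recurrence (fun m => colEnd_latticeVec δ.row m) (fun m k hm => ?_)
      (latticeVec_eq_zero_of_dvd_col _ (dvd_zero _)) (latticeVec_eq_zero_of_dvd_col _ dvd_rfl) h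
      (Int.natCast_dvd_natCast.2 hcol)
    refine (hS.adj_mem (a := δ.row) (m := m - k) hm ?_ ?_).2
    · rw [map_add, rowSignEnd_latticeVec, rowSignEnd_latticeVec, smul_add]
    · rw [map_add, colSignEnd_latticeVec, colSignEnd_latticeVec, smul_add, negOnePow_add_eq]
  refine mem_of_gcd_dvd_of_recurrence (F := fun a => latticeVec K e d a δ'.col)
    (fun a => rowEnd_latticeVec a δ'.col) (fun a k ha => ?_)
    (latticeVec_eq_zero_of_dvd_row (dvd_zero _) _) (latticeVec_eq_zero_of_dvd_row dvd_rfl _) h_col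
    (Int.natCast_dvd_natCast.2 hrow)
  refine (hS.adj_mem (a := a - k) (m := δ'.col) ha ?_ ?_).1
  · rw [map_add, rowSignEnd_latticeVec, rowSignEnd_latticeVec, smul_add, negOnePow_add_eq]
  · rw [map_add, colSignEnd_latticeVec, colSignEnd_latticeVec, smul_add]

end Sufficiency

section CosSq

lemma eq_zero_of_forall_norm_embedding_lt_one {L : Type*} [Field L] [NumberField L] {x : L}
    (hx : IsIntegral ℤ x) (h : ∀ φ : L →+* ℂ, ‖φ x‖ < 1) : x = 0 := by
  by_contra h0
  obtain ⟨n, hn, h_pow⟩ := NumberField.Embeddings.pow_eq_one_of_norm_le_one L ℂ h0 hx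
    fun φ => (h φ).le
  obtain ⟨φ⟩ : Nonempty (L →+* ℂ) := inferInstance
  refine (pow_lt_one₀ (norm_nonneg _) (h φ) hn.ne').ne ?_
  rw [← norm_pow, ← map_pow, h_pow, map_one, norm_one]

/-- The elements `2 + η + η⁻¹` for a `d`-th root of unity `η`; in `ℂ` and for
`d ≠ 0` these are the numbers `4 cos ^ 2 (k π / d)`, that is, `4` and the squares of the eigenvalues
of the path `1, …, d - 1`. -/
def IsCosSq {L : Type*} [Field L] (d : ℕ) (y : L) : Prop := ∃ η : L, η ^ d = 1 ∧ y = 2 + η + η⁻¹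

namespace IsCosSq

variable {L F : Type*} [Field L] [Field F] {d : ℕ}

lemma map {y : L} (hy : IsCosSq d y) (f : L →+* F) : IsCosSq d (f y) := by
  obtain ⟨η, hη, rfl⟩ := hy
  exact ⟨f η, by rw [← map_pow, hη, map_one], by simp [map_ofNat f]⟩

lemma isIntegral (hd : d ≠ 0) {y : L} (hy : IsCosSq d y) : IsIntegral ℤ y := by
  obtain ⟨η, hη, rfl⟩ := hy
  have h_root {ξ : L} (hξ : ξ ^ d = 1) : IsIntegral ℤ ξ :=
    .of_pow (Nat.pos_of_ne_zero hd) (hξ ▸ isIntegral_one)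
  exact ((map_ofNat (algebraMap ℤ L) 2 ▸ isIntegral_algebraMap).add (h_root hη)).add
    (h_root (by rw [inv_pow, hη, inv_one]))

lemma exists_real (hd : d ≠ 0) {y : ℂ} (hy : IsCosSq d y) : ∃ r ∈ Set.Icc (0 : ℝ) 4, y = r := by
  obtain ⟨η, hη, rfl⟩ := hy
  have h_norm : ‖η‖ = 1 := Complex.norm_eq_one_of_pow_eq_one hη hd
  have h_re := abs_le.1 (h_norm ▸ Complex.abs_re_le_norm η)
  refine ⟨2 + 2 * η.re, ⟨by linarith, by linarith⟩, ?_⟩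
  rw [Complex.inv_eq_conj h_norm, add_assoc, Complex.add_conj]
  push_cast
  rfl

lemma exists_cyclotomicField [NeZero d] (ι : CyclotomicField d ℚ →+* ℂ) {y : ℂ}
    (hy : IsCosSq d y) : ∃ a, IsCosSq d a ∧ ι a = y := by
  obtain ⟨η, hη, rfl⟩ := hy
  obtain ⟨z, hz⟩ := (CyclotomicField.isCyclotomicExtension d ℚ).exists_isPrimitiveRoot
    (Set.mem_singleton d) (NeZero.ne d)
  obtain ⟨i, -, rfl⟩ := (hz.map_of_injective ι.injective).eq_pow_of_pow_eq_one hη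
  exact ⟨2 + z ^ i + (z ^ i)⁻¹,
    ⟨z ^ i, by rw [← pow_mul, mul_comm, pow_mul, hz.pow_eq_one, one_pow], rfl⟩,
    by simp [map_ofNat ι]⟩

lemma three_dvd (h : IsCosSq d (1 : ℂ)) : 3 ∣ d := by
  obtain ⟨η, hη, h⟩ := h
  have h0 : η ≠ 0 := by
    rintro rfl
    norm_num at h
  have h_quad : η ^ 2 + η + 1 = 0 := by
    field_simp at h
    linear_combination -h
  have h_ne : η ≠ 1 := by
    rintro rfl
    norm_num at h_quad
  have h_cube : η ^ 3 = 1 := by linear_combination (η - 1) * h_quad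
  exact orderOf_eq_prime (p := 3) h_cube h_ne ▸ orderOf_dvd_of_pow_eq_one hη

lemma four_dvd (h : IsCosSq d (2 : ℂ)) : 4 ∣ d := by
  obtain ⟨η, hη, h⟩ := h
  rcases eq_or_ne η 0 with rfl | h0
  · obtain rfl : d = 0 := by
      by_contra hd
      simp [zero_pow hd] at hη
    exact dvd_zero 4
  have h_sq : η ^ 2 = -1 := by
    field_simp at h
    linear_combination -h
  have h_order : orderOf η = 2 ^ (1 + 1) := by
    refine orderOf_eq_prime_pow (by norm_num [h_sq]) ?_
    linear_combination (η ^ 2 - 1) * h_sq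
  exact (show 4 = 2 ^ (1 + 1) by norm_num) ▸ h_order ▸ orderOf_dvd_of_pow_eq_one hη

/-- The conjugates `r`, `r'` of `a`, `a'` lie in `[0, 4]`, and `0 ≤ (r - r') ^ 2` and
`0 ≤ (4 - r) (4 - r')` then confine those of `c` to `(-1, 1)`. -/
lemma eq_zero_of_add_eq_of_mul_eq [NumberField L] (hd : d ≠ 0) {n : ℕ} (hn : n = 1 ∨ n = 2)
    {a a' c : L} (ha : IsCosSq d a) (ha' : IsCosSq d a') (h_add : a + a' = (2 + n) * c + 2 * n)
    (h_mul : a * a' = (c - n) ^ 2) : c = 0 := by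
  have hc : IsIntegral ℤ c := by
    have : IsIntegral ℤ (c - n) := .of_pow two_pos
      (h_mul ▸ (ha.isIntegral hd).mul (ha'.isIntegral hd))
    simpa using this.add (isIntegral_natCast n)
  refine eq_zero_of_forall_norm_embedding_lt_one hc fun φ => ?_
  obtain ⟨r, ⟨hr, hr4⟩, har⟩ := (ha.map φ).exists_real hd
  obtain ⟨r', ⟨hr', hr4'⟩, har'⟩ := (ha'.map φ).exists_real hd
  have h_add' := congrArg φ h_add
  have h_mul' := congrArg φ h_mul
  simp only [map_add, map_mul, map_sub, map_pow, map_natCast, map_ofNat, har, har'] at h_add' h_mul'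
  have h_real : φ c = ((r + r' - 2 * n) / (2 + n) : ℝ) := by
    have : (2 + n : ℂ) ≠ 0 := by norm_cast; omega
    push_cast
    field_simp
    linear_combination -h_add'
  rw [h_real] at h_mul' ⊢
  norm_cast at h_mul'
  rw [Complex.norm_real, Real.norm_eq_abs, abs_lt]
  have h_four : 0 ≤ (4 - r) * (4 - r') := mul_nonneg (by linarith) (by linarith)
  rcases hn with rfl | rfl <;> norm_num at h_mul' ⊢ <;> constructor <;>
    nlinarith [sq_nonneg (r - r')]

end IsCosSq

namespace EigenRelation

variable {d : ℕ}

/-- If `y ≠ y'`, these are the two roots of the relation as a quadratic equation in `y`; their sum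
and product force the algebraic integer `l` to vanish, which makes `n` the double root. -/
lemma eq_of_isCosSq (hd : d ≠ 0) {n : ℕ} (hn : n = 1 ∨ n = 2) (hnd : ¬ IsCosSq d (n : ℂ))
    {l y y' : ℂ} (hy : IsCosSq d y) (hy' : IsCosSq d y') (h : EigenRelation l n y)
    (h' : EigenRelation l n y') : y = y' := by
  by_contra hne
  unfold EigenRelation at h h'
  have h_add : y + y' = (2 + n) * l + 2 * n := by
    apply mul_left_cancel₀ (sub_ne_zero.2 hne)
    linear_combination h - h'
  have h_mul : y * y' = (l - n) ^ 2 := by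
    linear_combination y * h_add - h
  have : NeZero d := ⟨hd⟩
  obtain ⟨ι⟩ : Nonempty (CyclotomicField d ℚ →+* ℂ) := inferInstance
  obtain ⟨a, ha, rfl⟩ := hy.exists_cyclotomicField ι
  obtain ⟨a', ha', rfl⟩ := hy'.exists_cyclotomicField ι
  obtain ⟨c, rfl⟩ : ∃ c, ι c = l := by
    refine ⟨(a + a' - 2 * n) / (2 + n), ?_⟩
    have : (2 + n : ℂ) ≠ 0 := by norm_cast; omega
    simp only [map_div₀, map_sub, map_add, map_mul, map_natCast, map_ofNat]
    field_simp
    linear_combination h_add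
  have hc : c = 0 := ha.eq_zero_of_add_eq_of_mul_eq hd hn ha'
    (ι.injective (by simpa [map_ofNat ι] using h_add)) (ι.injective (by simpa using h_mul))
  rw [hc, map_zero] at h
  have h_sq : (ι a - n) ^ 2 = 0 := by linear_combination h
  exact hnd (sub_eq_zero.1 (pow_eq_zero_iff two_ne_zero |>.1 h_sq) ▸ hy)

lemma four_dvd_of_isCosSq (hd : d ≠ 0) {l y : ℂ} (hl : IsCosSq d l) (hy : IsCosSq d y)
    (h : EigenRelation l 2 y) : 4 ∣ d := by
  have h_sq : (l + y - 2) ^ 2 = 6 * (l * y) := by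
    unfold EigenRelation at h
    linear_combination h
  have h_mul : l * y = 0 := by
    have : NeZero d := ⟨hd⟩
    obtain ⟨ι⟩ : Nonempty (CyclotomicField d ℚ →+* ℂ) := inferInstance
    obtain ⟨c, hc, rfl⟩ := hl.exists_cyclotomicField ι
    obtain ⟨a, ha, rfl⟩ := hy.exists_cyclotomicField ι
    have h_sq' : (c + a - 2) ^ 2 = 6 * (c * a) := ι.injective (by simpa [map_ofNat ι] using h_sq)
    rw [← map_mul, eq_zero_of_forall_norm_embedding_lt_one
      ((hc.isIntegral hd).mul (ha.isIntegral hd)) fun φ => ?_, map_zero]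
    obtain ⟨r, ⟨hr, hr4⟩, hcr⟩ := (hc.map φ).exists_real hd
    obtain ⟨r', ⟨hr', hr4'⟩, har⟩ := (ha.map φ).exists_real hd
    have h_real := congrArg φ h_sq'
    simp only [map_add, map_mul, map_sub, map_pow, map_ofNat, hcr, har] at h_real ⊢
    norm_cast at h_real ⊢
    rw [Real.norm_eq_abs, abs_lt]
    have h_four : 0 ≤ (4 - r) * (4 - r') := mul_nonneg (by linarith) (by linarith)
    have h_nonneg : 0 ≤ r * r' := mul_nonneg hr hr'
    have h_le : r + r' ≤ 17 / 4 := by nlinarith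
    exact ⟨by linarith, by nlinarith⟩
  have h_add : l + y = 2 := by
    rw [h_mul, mul_zero, pow_eq_zero_iff two_ne_zero] at h_sq
    exact sub_eq_zero.1 h_sq
  rcases mul_eq_zero.1 h_mul with rfl | rfl
  · exact (show y = 2 by simpa using h_add) ▸ hy |>.four_dvd
  · exact (show l = 2 by simpa using h_add) ▸ hl |>.four_dvd

end EigenRelation

end CosSq

section Eigenspaces

lemma iSup_eigenspace_eq_top_of_isHermitian {n : Type*} [Fintype n] [DecidableEq n]
    {A : Matrix n n ℂ} (hA : A.IsHermitian) :
    ⨆ μ, Module.End.eigenspace (Matrix.toLinAlgEquiv' A) μ = ⊤ := by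
  rw [eq_top_iff, ← (hA.eigenvectorBasis.toBasis.map (WithLp.linearEquiv 2 ℂ (n → ℂ))).span_eq,
    Submodule.span_le]
  rintro _ ⟨i, rfl⟩
  refine Submodule.mem_iSup_of_mem (hA.eigenvalues i : ℂ) ?_
  simpa using hA.mulVec_eigenvectorBasis i

variable {K V : Type*} [Field K] [AddCommGroup V] [Module K V] [FiniteDimensional K V]

lemma mem_of_sub_smul_apply_mem {f : Module.End K V} {S : Submodule K V} (hS : ∀ v ∈ S, f v ∈ S)
    {x : K} (hx : ¬ f.HasEigenvalue x) {v : V} (hv : f v - x • v ∈ S) : v ∈ S := by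
  have h_inj : Function.Injective (f - x • (1 : Module.End K V)) := by
    rw [← LinearMap.ker_eq_bot, ← Module.End.eigenspace_def]
    exact not_not.1 hx
  have h_map : S.map (f - x • (1 : Module.End K V)) = S := by
    refine Submodule.eq_of_le_of_finrank_eq ?_
      (LinearEquiv.finrank_eq (Submodule.equivMapOfInjective _ h_inj S)).symm
    rintro _ ⟨w, hw, rfl⟩
    exact S.sub_mem (hS w hw) (S.smul_mem x hw)
  obtain ⟨w, hw, h_eq⟩ := h_map.ge hv
  rwa [← h_inj h_eq]

lemma exists_inf_eigenspace_ne_bot {X : Module.End K V} (hX : ⨆ x, X.eigenspace x = ⊤)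
    {W : Submodule K V} (hW : ∀ v ∈ W, X v ∈ W) (hW' : W ≠ ⊥) : ∃ x, W ⊓ X.eigenspace x ≠ ⊥ := by
  contrapose! hW'
  rw [Submodule.eq_iSup_inf_genEigenspace 1 hW hX]
  exact iSup_eq_bot.2 hW'

lemma exists_le_eigenspace {X : Module.End K V} (hX : ⨆ x, X.eigenspace x = ⊤)
    {W : Submodule K V} (hW : ∀ v ∈ W, X v ∈ W)
    (h_unique : ∀ x x', W ⊓ X.eigenspace x ≠ ⊥ → W ⊓ X.eigenspace x' ≠ ⊥ → x = x') :
    ∃ x, W ≤ X.eigenspace x := by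
  rcases eq_or_ne W ⊥ with rfl | hW'
  · exact ⟨0, bot_le⟩
  obtain ⟨x, hx⟩ := exists_inf_eigenspace_ne_bot hX hW hW'
  refine ⟨x, ?_⟩
  conv_lhs => rw [Submodule.eq_iSup_inf_genEigenspace 1 hW hX]
  refine iSup_le fun x' => ?_
  rcases eq_or_ne (W ⊓ X.eigenspace x') ⊥ with h | h
  · exact h.trans_le bot_le
  · exact h_unique x x' hx h ▸ inf_le_right

lemma apply_mem_of_eigenvalue_unique {T X : Module.End K V} (hT : ⨆ l, T.eigenspace l = ⊤)
    (hX : ⨆ x, X.eigenspace x = ⊤) (hTX : Commute T X)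
    (h_unique : ∀ l x x', T.eigenspace l ⊓ X.eigenspace x ≠ ⊥ →
      T.eigenspace l ⊓ X.eigenspace x' ≠ ⊥ → x = x')
    {S : Submodule K V} (hS : ∀ v ∈ S, T v ∈ S) : ∀ v ∈ S, X v ∈ S := by
  suffices S ≤ S.comap X from this
  conv_lhs => rw [Submodule.eq_iSup_inf_genEigenspace 1 hS hT]
  refine iSup_le fun l v hv => ?_
  obtain ⟨x, hx⟩ := exists_le_eigenspace hX (Module.End.mapsTo_genEigenspace_of_comm hTX l 1)
    (h_unique l)
  rw [Submodule.mem_comap, Module.End.mem_eigenspace_iff.1 (hx hv.2)]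
  exact S.smul_mem x hv.1

lemma apply_mem_of_joint_eigenvalues_unique {T X Y : Module.End K V}
    (hT : ⨆ l, T.eigenspace l = ⊤) (hX : ⨆ x, X.eigenspace x = ⊤) (hY : ⨆ y, Y.eigenspace y = ⊤)
    (hTX : Commute T X) (hTY : Commute T Y) (hXY : Commute X Y)
    (h_unique : ∀ l x y x' y', T.eigenspace l ⊓ X.eigenspace x ⊓ Y.eigenspace y ≠ ⊥ →
      T.eigenspace l ⊓ X.eigenspace x' ⊓ Y.eigenspace y' ≠ ⊥ → x = x' ∧ y = y')
    {S : Submodule K V} (hS : ∀ v ∈ S, T v ∈ S) : ∀ v ∈ S, X v ∈ S ∧ Y v ∈ S := by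
  have exists_third {A B C : Module.End K V} (hC : ⨆ c, C.eigenspace c = ⊤) (hAC : Commute A C)
      (hBC : Commute B C) {a b : K} (h : A.eigenspace a ⊓ B.eigenspace b ≠ ⊥) :
      ∃ c, A.eigenspace a ⊓ B.eigenspace b ⊓ C.eigenspace c ≠ ⊥ :=
    exists_inf_eigenspace_ne_bot hC (fun v hv =>
      ⟨Module.End.mapsTo_genEigenspace_of_comm hAC a 1 hv.1,
        Module.End.mapsTo_genEigenspace_of_comm hBC b 1 hv.2⟩) h
  refine fun v hv => ⟨apply_mem_of_eigenvalue_unique hT hX hTX (fun l x x' hx hx' => ?_) hS v hv,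
    apply_mem_of_eigenvalue_unique hT hY hTY (fun l y y' hy hy' => ?_) hS v hv⟩
  · obtain ⟨y, hy⟩ := exists_third hY hTY hXY hx
    obtain ⟨y', hy'⟩ := exists_third hY hTY hXY hx'
    exact (h_unique l x y x' y' hy hy').1
  · obtain ⟨x, hx⟩ := exists_third hX hTX hXY.symm hy
    obtain ⟨x', hx'⟩ := exists_third hX hTX hXY.symm hy'
    rw [inf_right_comm] at hx hx'
    exact (h_unique l x y x' y' hx hx').2

end Eigenspaces

section Spectra

lemma spectrum_one_kronecker {R ι κ : Type*} [CommRing R] [Fintype ι] [DecidableEq ι] [Nonempty ι]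
    [Fintype κ] [DecidableEq κ] (A : Matrix κ κ R) :
    spectrum R ((1 : Matrix ι ι R) ⊗ₖ A) = spectrum R A := by
  ext x
  have h_sub : algebraMap R (Matrix (ι × κ) (ι × κ) R) x - 1 ⊗ₖ A =
      1 ⊗ₖ (algebraMap R (Matrix κ κ R) x - A) := by
    rw [sub_eq_iff_eq_add, ← Matrix.kronecker_add, sub_add_cancel, Algebra.algebraMap_eq_smul_one,
      Algebra.algebraMap_eq_smul_one, Matrix.kronecker_smul, Matrix.one_kronecker_one]
  rw [spectrum.mem_iff, spectrum.mem_iff, h_sub, Matrix.isUnit_iff_isUnit_det,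
    Matrix.isUnit_iff_isUnit_det, Matrix.det_kronecker, Matrix.det_one, one_pow, one_mul,
    isUnit_pow_iff Fintype.card_ne_zero]

lemma isHermitian_pathAdj (n : ℕ) : (pathAdj ℂ n).IsHermitian := by
  rw [Matrix.IsHermitian, Matrix.conjTranspose, pathAdj_isSymm.eq]
  exact mapMatrix_pathAdj (starRingEnd ℂ)

variable {e d : ℕ}

lemma spectrum_colAdj (he : 2 ≤ e) : spectrum ℂ (colAdj ℂ e d) =
    (fun k : ℕ => (2 * (Real.cos (k * Real.pi / d) : ℝ) : ℂ)) '' Finset.Ico 1 d := by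
  have : Nonempty (Finset.Ico 1 e) := ⟨⟨1, Finset.mem_Ico.2 ⟨le_rfl, he⟩⟩⟩
  rw [colAdj, spectrum_one_kronecker, spectrum_pathAdj]

lemma isCosSq_two_mul_cos_sq (k : ℕ) (hd : d ≠ 0) :
    IsCosSq d ((2 * (Real.cos (k * Real.pi / d) : ℝ) : ℂ) ^ 2) := by
  refine ⟨Complex.exp (2 * (k * Real.pi / d) * Complex.I), ?_, ?_⟩
  · rw [← Complex.exp_nat_mul, Complex.exp_eq_one_iff]
    refine ⟨k, ?_⟩
    have : (d : ℂ) ≠ 0 := Nat.cast_ne_zero.2 hd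
    push_cast
    field_simp
  · push_cast
    rw [mul_pow, Complex.cos_sq, ← Complex.exp_neg, ← neg_mul, add_assoc, ← Complex.two_cos]
    ring

lemma isCosSq_of_hasEigenvalue_colEnd_sq (he : 2 ≤ e) {y : ℂ}
    (hy : (colEnd ℂ e d * colEnd ℂ e d).HasEigenvalue y) : IsCosSq d y := by
  have h_mem := hy.mem_spectrum
  rw [colEnd, ← map_mul, AlgEquiv.spectrum_eq, ← pow_two, spectrum.map_pow_of_pos _ two_pos,
    spectrum_colAdj he, Set.image_image] at h_mem
  obtain ⟨k, hk, rfl⟩ := h_mem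
  exact isCosSq_two_mul_cos_sq k (by grind)

lemma isHermitian_rowAdj : (rowAdj ℂ e d).IsHermitian := by
  rw [Matrix.IsHermitian, rowAdj, Matrix.conjTranspose_kronecker, isHermitian_pathAdj,
    Matrix.conjTranspose_one]

lemma isHermitian_colAdj : (colAdj ℂ e d).IsHermitian := by
  rw [Matrix.IsHermitian, colAdj, Matrix.conjTranspose_kronecker, isHermitian_pathAdj,
    Matrix.conjTranspose_one]

lemma iSup_eigenspace_rowEnd_sq :
    ⨆ x, Module.End.eigenspace (rowEnd ℂ e d * rowEnd ℂ e d) x = ⊤ := by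
  rw [rowEnd, ← map_mul, ← pow_two]
  exact iSup_eigenspace_eq_top_of_isHermitian (isHermitian_rowAdj.pow 2)

lemma iSup_eigenspace_colEnd_sq :
    ⨆ y, Module.End.eigenspace (colEnd ℂ e d * colEnd ℂ e d) y = ⊤ := by
  rw [colEnd, ← map_mul, ← pow_two]
  exact iSup_eigenspace_eq_top_of_isHermitian (isHermitian_colAdj.pow 2)

lemma isHermitian_rowSign : (rowSign ℂ e d).IsHermitian := by
  rw [rowSign_eq_diagonal, Matrix.isHermitian_diagonal_iff]
  simp [isSelfAdjoint_iff]

lemma isHermitian_colSign : (colSign ℂ e d).IsHermitian := by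
  rw [colSign_eq_diagonal, Matrix.isHermitian_diagonal_iff]
  simp [isSelfAdjoint_iff]

lemma iSup_eigenspace_varEnd : ⨆ l, (varEnd ℂ e d).eigenspace l = ⊤ := by
  have h_star := (isGrid_matrix ℂ e d).star_gridVar (K := ℂ) isHermitian_rowAdj isHermitian_colAdj
    isHermitian_rowSign isHermitian_colSign
  have h_smul : (Complex.I • gridVar ℂ (rowAdj ℂ e d) (colAdj ℂ e d) (rowSign ℂ e d)
      (colSign ℂ e d)).IsHermitian := by
    rw [Matrix.IsHermitian, ← Matrix.star_eq_conjTranspose, star_smul, h_star]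
    simp
  rw [eq_top_iff, ← iSup_eigenspace_eq_top_of_isHermitian h_smul]
  refine iSup_le fun μ => le_iSup_of_le (-Complex.I * μ) fun v hv => ?_
  rw [Module.End.mem_eigenspace_iff, map_smul, LinearMap.smul_apply,
    ← varEnd_eq_toLinAlgEquiv'] at hv
  rw [Module.End.mem_eigenspace_iff, mul_smul, ← hv, smul_smul, neg_mul, Complex.I_mul_I, neg_neg,
    one_smul]

end Spectra

section AdjClosed

variable {e d : ℕ}

lemma eigenRelation_of_joint_eigenspace_ne_bot (he : 2 ≤ e) {l x y : ℂ}
    (h : (varEnd ℂ e d).eigenspace l ⊓ (rowEnd ℂ e d * rowEnd ℂ e d).eigenspace x ⊓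
      (colEnd ℂ e d * colEnd ℂ e d).eigenspace y ≠ ⊥) :
    (rowEnd ℂ e d * rowEnd ℂ e d).HasEigenvalue x ∧ IsCosSq d y ∧ EigenRelation (-l ^ 2) x y := by
  obtain ⟨v, ⟨⟨hl, hx⟩, hy⟩, hv⟩ := Submodule.exists_mem_ne_zero_of_ne_bot h
  exact ⟨Module.End.hasEigenvalue_of_hasEigenvector ⟨hx, hv⟩,
    isCosSq_of_hasEigenvalue_colEnd_sq he (Module.End.hasEigenvalue_of_hasEigenvector ⟨hy, hv⟩),
    (isGrid_end ℂ e d).eigenRelation hv (Module.End.mem_eigenspace_iff.1 hl)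
      (Module.End.mem_eigenspace_iff.1 hx) (Module.End.mem_eigenspace_iff.1 hy)⟩

lemma adjClosed_Mon (hd : d ≠ 0) {x₀ : ℂ} (h_re : 0 ≤ x₀.re) (hx₀ : ¬ IsCosSq d x₀)
    (h_cube : ∀ v, rowEnd ℂ e d (rowEnd ℂ e d (rowEnd ℂ e d v)) = x₀ • rowEnd ℂ e d v)
    (h_unique : ∀ l x y x' y' : ℂ, (rowEnd ℂ e d * rowEnd ℂ e d).HasEigenvalue x →
      (rowEnd ℂ e d * rowEnd ℂ e d).HasEigenvalue x' → IsCosSq d y → IsCosSq d y' →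
      EigenRelation l x y → EigenRelation l x' y' → x = x' ∧ y = y')
    (δ : VanCycle e d) : AdjClosed (Mon ℂ δ) := by
  have h := isGrid_end ℂ e d
  have he : 2 ≤ e := by have := Finset.mem_Ico.1 δ.1.2; omega
  have h_sq := apply_mem_of_joint_eigenvalues_unique iSup_eigenspace_varEnd
    iSup_eigenspace_rowEnd_sq iSup_eigenspace_colEnd_sq h.commute_gridVar_p_sq
    h.commute_gridVar_q_sq
    (.mul_left (.mul_right h.q_mul_p.symm h.q_mul_p.symm)
      (.mul_right h.q_mul_p.symm h.q_mul_p.symm))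
    (fun l x y x' y' h_ne h_ne' => by
      obtain ⟨hx, hy, h_rel⟩ := eigenRelation_of_joint_eigenspace_ne_bot he h_ne
      obtain ⟨hx', hy', h_rel'⟩ := eigenRelation_of_joint_eigenspace_ne_bot he h_ne'
      exact h_unique _ x y x' y' hx hx' hy hy' h_rel h_rel')
    (S := Mon ℂ δ) (fun v => varEnd_mem_Mon δ)
  have mem_of_sub {z : ℂ} (hz : ¬ IsCosSq d z) (v : VanCycle e d → ℂ) :
      colEnd ℂ e d (colEnd ℂ e d v) - z • v ∈ Mon ℂ δ → v ∈ Mon ℂ δ :=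
    mem_of_sub_smul_apply_mem (fun v hv => (h_sq v hv).2)
      (mt (isCosSq_of_hasEigenvalue_colEnd_sq he) hz)
  have h_neg : ¬ IsCosSq d (-(x₀ + 4)) := fun hc => by
    obtain ⟨r, hr, h_eq⟩ := hc.exists_real hd
    have := congrArg Complex.re h_eq
    simp at this
    linarith [hr.1]
  exact fun v hv => h.adj_mem (fun v => varEnd_mem_Mon δ) (fun v hv => (h_sq v hv).1)
    (fun v hv => (h_sq v hv).2) h_cube (mem_of_sub hx₀)
    (fun v hv => mem_of_sub h_neg v (by rwa [neg_smul, sub_neg_eq_add])) hv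

theorem adjClosed_Mon_two (δ : VanCycle 2 d) : AdjClosed (Mon ℂ δ) := by
  have h_row : rowEnd ℂ 2 d = 0 := by
    rw [rowEnd, rowAdj, pathAdj_two, Matrix.zero_kronecker, map_zero]
  intro v hv _ ht
  refine ⟨by rw [h_row]; exact Submodule.zero_mem _, ?_⟩
  have h_var : varEnd ℂ 2 d v = colEnd ℂ 2 d (colSignEnd ℂ 2 d v) := by
    rw [varEnd, IsGrid.gridVar_apply, h_row]
    simp
  have h_mem := varEnd_mem_Mon δ hv
  rcases ht with ht | ht <;> simpa [h_var, ht] using h_mem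

theorem adjClosed_Mon_three (hd : ¬ 3 ∣ d) (δ : VanCycle 3 d) : AdjClosed (Mon ℂ δ) := by
  have hd₀ : d ≠ 0 := by rintro rfl; exact hd (dvd_zero 3)
  have h_one : ¬ IsCosSq d (1 : ℂ) := mt IsCosSq.three_dvd hd
  have h_sq : rowEnd ℂ 3 d * rowEnd ℂ 3 d = 1 := by
    rw [rowEnd, ← map_mul, rowAdj, ← Matrix.mul_kronecker_mul, pathAdj_three_mul_self, mul_one,
      Matrix.one_kronecker_one, map_one]
  have eq_one {x : ℂ} (hx : (rowEnd ℂ 3 d * rowEnd ℂ 3 d).HasEigenvalue x) : x = 1 := by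
    obtain ⟨v, hv⟩ := hx.exists_hasEigenvector
    have := hv.apply_eq_smul
    rw [h_sq, Module.End.one_apply] at this
    exact smul_left_injective ℂ hv.2 (by simpa using this.symm)
  refine adjClosed_Mon hd₀ (x₀ := 1) (by simp) h_one (fun v => ?_) ?_ δ
  · rw [← Module.End.mul_apply, h_sq, one_smul, Module.End.one_apply]
  · intro l x y x' y' hx hx' hy hy' h h'
    obtain rfl := eq_one hx
    obtain rfl := eq_one hx'
    refine ⟨rfl, EigenRelation.eq_of_isCosSq hd₀ (n := 1) (l := l) (Or.inl rfl) ?_ hy hy' ?_ ?_⟩ <;>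
      rwa [Nat.cast_one]

theorem adjClosed_Mon_four (hd : ¬ 4 ∣ d) (δ : VanCycle 4 d) : AdjClosed (Mon ℂ δ) := by
  have hd₀ : d ≠ 0 := by rintro rfl; exact hd (dvd_zero 4)
  have h_cube (v : VanCycle 4 d → ℂ) :
      rowEnd ℂ 4 d (rowEnd ℂ 4 d (rowEnd ℂ 4 d v)) = (2 : ℂ) • rowEnd ℂ 4 d v := by
    have h_mul : rowEnd ℂ 4 d * (rowEnd ℂ 4 d * rowEnd ℂ 4 d) = (2 : ℂ) • rowEnd ℂ 4 d := by
      rw [rowEnd, ← map_mul, ← map_mul, rowAdj, ← Matrix.mul_kronecker_mul,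
        ← Matrix.mul_kronecker_mul, mul_one, mul_one, pathAdj_four_mul_self_mul_self,
        Matrix.smul_kronecker, map_nsmul, two_smul, two_smul]
    exact LinearMap.congr_fun h_mul v
  have eq_zero_or_two {x : ℂ} (hx : (rowEnd ℂ 4 d * rowEnd ℂ 4 d).HasEigenvalue x) :
      x = 0 ∨ x = 2 := by
    obtain ⟨v, hv⟩ := hx.exists_hasEigenvector
    have hv' : rowEnd ℂ 4 d (rowEnd ℂ 4 d v) = x • v := hv.apply_eq_smul
    have h_sq := h_cube (rowEnd ℂ 4 d v)
    simp only [hv', map_smul, smul_smul] at h_sq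
    exact (mul_eq_mul_right_iff.1 (smul_left_injective ℂ hv.2 h_sq)).symm
  refine adjClosed_Mon hd₀ (x₀ := 2) (by simp) (mt IsCosSq.four_dvd hd) h_cube ?_ δ
  intro l x y x' y' hx hx' hy hy' h h'
  rcases eq_zero_or_two hx with rfl | rfl <;> rcases eq_zero_or_two hx' with rfl | rfl
  · exact ⟨rfl, h.eq_of_zero.symm.trans h'.eq_of_zero⟩
  · exact absurd (h'.four_dvd_of_isCosSq hd₀ (h.eq_of_zero ▸ hy) hy') hd
  · exact absurd (h.four_dvd_of_isCosSq hd₀ (h'.eq_of_zero ▸ hy') hy) hd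
  · refine ⟨rfl, EigenRelation.eq_of_isCosSq hd₀ (n := 2) (l := l) (Or.inr rfl) ?_ hy hy' ?_ ?_⟩
    · exact mt IsCosSq.four_dvd hd
    · exact h
    · exact h'

end AdjClosed

section DegreeTwo

open scoped Pointwise

lemma spectrum_mul_of_anticomm {A : Type*} [Ring A] [Algebra ℂ A] {q t : A} (ht : t * t = 1)
    (h : t * q = -(q * t)) : spectrum ℂ (q * t) = spectrum ℂ (Complex.I • q) := by
  have I_smul_I_smul (a : A) : Complex.I • Complex.I • a = -a := by
    rw [smul_smul, Complex.I_mul_I, neg_one_smul]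
  have h_inv : (1 + Complex.I • t) * ((2⁻¹ : ℂ) • (1 - Complex.I • t)) = 1 := by
    rw [mul_smul_comm]
    simp only [add_mul, mul_sub, one_mul, mul_one, smul_mul_assoc, mul_smul_comm, ht,
      smul_add, smul_sub, I_smul_I_smul]
    module
  have h_inv' : ((2⁻¹ : ℂ) • (1 - Complex.I • t)) * (1 + Complex.I • t) = 1 := by
    rw [smul_mul_assoc]
    simp only [sub_mul, mul_add, one_mul, mul_one, smul_mul_assoc, mul_smul_comm, ht,
      smul_add, smul_sub, I_smul_I_smul]
    module
  let u : Aˣ := ⟨1 + Complex.I • t, (2⁻¹ : ℂ) • (1 - Complex.I • t), h_inv, h_inv'⟩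
  have h_conj : ↑u * (Complex.I • q) * ↑u⁻¹ = q * t := by
    rw [Units.mul_inv_eq_iff_eq_mul]
    simp only [u, add_mul, mul_add, one_mul, mul_one, smul_mul_assoc, mul_smul_comm, mul_assoc, h,
      ht, smul_add, smul_neg, I_smul_I_smul, neg_neg, add_comm]
  rw [← h_conj, spectrum.units_conjugate]

theorem spectrum_monodromyMatrix_two (d : ℕ) :
    spectrum ℂ (monodromyMatrix ℂ 2 d) =
      {z : ℂ | ∃ j : ℕ, 1 ≤ j ∧ j ≤ d - 1 ∧
        z = 1 + 2 * Complex.I * ((Real.cos (j * Real.pi / d) : ℝ) : ℂ)} := by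
  have h_var : gridVar ℂ (rowAdj ℂ 2 d) (colAdj ℂ 2 d) (rowSign ℂ 2 d) (colSign ℂ 2 d) =
      colAdj ℂ 2 d * colSign ℂ 2 d := by
    rw [gridVar, rowAdj, pathAdj_two, Matrix.zero_kronecker, zero_mul, zero_mul, zero_mul,
      smul_zero, zero_add, sub_zero]
  have h := isGrid_matrix ℂ 2 d
  have h_smul : spectrum ℂ (Complex.I • colAdj ℂ 2 d) = Complex.I • spectrum ℂ (colAdj ℂ 2 d) :=
    spectrum.unit_smul_eq_smul _ (Units.mk0 Complex.I Complex.I_ne_zero)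
  have h_add := spectrum.vadd_eq (colAdj ℂ 2 d * colSign ℂ 2 d) (1 : ℂ)
  rw [map_one, spectrum_mul_of_anticomm h.t_mul_t h.t_mul_q, h_smul,
    spectrum_colAdj le_rfl] at h_add
  rw [monodromyMatrix_eq, h_var, ← h_add]
  ext z
  simp only [Set.mem_vadd_set, Set.mem_smul_set, Set.mem_image]
  constructor
  · rintro ⟨_, ⟨_, ⟨j, hj, rfl⟩, rfl⟩, rfl⟩
    exact ⟨j, by grind, by grind, by simp only [vadd_eq_add, smul_eq_mul]; ring⟩
  · rintro ⟨j, h1, hd, rfl⟩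
    exact ⟨_, ⟨_, ⟨j, by simp; omega, rfl⟩, rfl⟩, by simp only [vadd_eq_add, smul_eq_mul]; ring⟩

end DegreeTwo

section Multiplicity

namespace IsGrid

variable {K : Type*} [Field K] {V : Type*} [AddCommGroup V] [Module K V]
  {p q s t : Module.End K V}

lemma sign_rules (h : IsGrid p q s t) (z : V) : p (s z) = -s (p z) ∧ p (t z) = t (p z) ∧
    q (s z) = s (q z) ∧ q (t z) = -t (q z) ∧ s (s z) = z ∧ t (t z) = z ∧ t (s z) = s (t z) := by
  obtain ⟨-, sp, sq, tp, tq⟩ := h.apply_rules z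
  exact ⟨by rw [sp, neg_neg], tp.symm, sq.symm, by rw [tq, neg_neg],
    LinearMap.congr_fun h.s_mul_s z, LinearMap.congr_fun h.t_mul_t z,
    LinearMap.congr_fun h.t_mul_s z⟩

lemma gridVar_apply_sub (h : IsGrid p q s t) {z : V} {x : K} (hp : p z = x • z) (hq : q z = x • z) :
    gridVar K p q s t (s z - t z) = 0 := by
  rw [gridVar_apply]
  simp only [map_add, map_sub, map_neg, map_smul, h.sign_rules, hp, hq]
  module

lemma gridVar_apply_add [CharZero K] (h : IsGrid p q s t) {z : V} {x : K} (hp : p z = x • z)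
    (hq : q z = x • z) :
    gridVar K p q s t (z + s (t z) + (x / 2) • (z - s (t z))) = 0 := by
  rw [gridVar_apply]
  simp only [map_sub, map_add, map_neg, map_smul, h.sign_rules, hp, hq]
  module

end IsGrid

lemma ncard_spectrum_lt_card {n : Type*} [Fintype n] [DecidableEq n] {A : Matrix n n ℂ} {μ : ℂ}
    {v w : n → ℂ} (hv : A *ᵥ v = μ • v) (hw : A *ᵥ w = μ • w)
    (h : LinearIndependent ℂ ![v, w]) : (spectrum ℂ A).ncard < Fintype.card n := by
  have h_count : 2 ≤ A.charpoly.roots.count μ := by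
    have h_mem (i : Fin 2) : ![v, w] i ∈ Module.End.eigenspace (Matrix.toLin' A) μ := by
      rw [Module.End.mem_eigenspace_iff, Matrix.toLin'_apply]
      fin_cases i
      exacts [hv, hw]
    have h_indep : LinearIndependent ℂ fun i =>
        (⟨![v, w] i, h_mem i⟩ : Module.End.eigenspace (Matrix.toLin' A) μ) :=
      .of_comp (Submodule.subtype _) h
    rw [Polynomial.count_roots, ← Matrix.charpoly_toLin']
    exact (by simpa using h_indep.fintype_card_le_finrank : 2 ≤ _).trans
      (LinearMap.finrank_eigenspace_le (Matrix.toLin' A) μ)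
  have h_card : A.charpoly.roots.toFinset.card < A.charpoly.roots.card := by
    refine (Multiset.toFinset_card_le _).lt_of_ne fun h_eq => ?_
    have := Multiset.nodup_iff_count_le_one.1 (Multiset.toFinset_card_eq_card_iff_nodup.1 h_eq) μ
    omega
  rw [spectrum_eq_toFinset_roots_charpoly, Set.ncard_coe_finset]
  exact h_card.trans_le ((Polynomial.card_roots' _).trans_eq A.charpoly_natDegree_eq_dim)

variable {e d : ℕ}

lemma linearIndependent_of_gridVar_ker {z : VanCycle e d → ℂ} (x : ℂ) {δ₁ δ₂ : VanCycle e d}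
    (h_row₁ : Odd δ₁.row) (h_col₁ : Odd δ₁.col) (h_row₂ : Even δ₂.row) (h_col₂ : Odd δ₂.col)
    (h₁ : z δ₁ ≠ 0) (h₂ : z δ₂ ≠ 0) :
    LinearIndependent ℂ ![rowSignEnd ℂ e d z - colSignEnd ℂ e d z,
      z + rowSignEnd ℂ e d (colSignEnd ℂ e d z) +
        (x / 2) • (z - rowSignEnd ℂ e d (colSignEnd ℂ e d z))] := by
  rw [LinearIndependent.pair_iff]
  intro a b hab
  have eval₁ := congrFun hab δ₁
  have eval₂ := congrFun hab δ₂
  simp only [rowSignEnd, colSignEnd, Matrix.toLinAlgEquiv'_apply, Pi.add_apply, Pi.smul_apply,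
    Pi.sub_apply, rowSign_eq_diagonal, colSign_eq_diagonal, Matrix.mulVec_diagonal,
    h_row₁.neg_one_pow, h_row₂.neg_one_pow, h_col₁.neg_one_pow, h_col₂.neg_one_pow, smul_eq_mul,
    Pi.zero_apply] at eval₁ eval₂
  have hb : b = 0 := by
    have : b * z δ₁ = 0 := by linear_combination eval₁ / 2
    exact (mul_eq_zero.1 this).resolve_right h₁
  subst hb
  have : a * z δ₂ = 0 := by linear_combination eval₂ / 2
  exact ⟨(mul_eq_zero.1 this).resolve_right h₂, rfl⟩

lemma sin_natCast_mul_pi_div_ne_zero {k : ℕ} (hk : k ∈ Finset.Ico 1 e) :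
    Complex.sin (k * (Real.pi / e)) ≠ 0 := by
  have h := (Real.sin_pos_of_mem_Ioo (natCast_mul_pi_div_mem_Ioo hk)).ne'
  rw [mul_div_assoc] at h
  exact_mod_cast h

lemma rowEnd_gridTensor_sin {α : ℂ} (hα : Complex.sin (e * α) = 0) (w : Finset.Ico 1 d → ℂ) :
    rowEnd ℂ e d (gridTensor (fun k => Complex.sin ((k : ℕ) * α)) w) =
      (2 * Complex.cos α) •
        gridTensor (fun k : Finset.Ico 1 e => Complex.sin ((k : ℕ) * α)) w := by
  rw [rowEnd_gridTensor, pathAdj_mulVec_sin hα]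
  exact funext fun _ => mul_assoc _ _ _

lemma colEnd_gridTensor_sin {α : ℂ} (hα : Complex.sin (d * α) = 0) (u : Finset.Ico 1 e → ℂ) :
    colEnd ℂ e d (gridTensor u fun k => Complex.sin ((k : ℕ) * α)) =
      (2 * Complex.cos α) •
        gridTensor u fun k : Finset.Ico 1 d => Complex.sin ((k : ℕ) * α) := by
  rw [colEnd_gridTensor, pathAdj_mulVec_sin hα]
  exact funext fun _ => mul_left_comm _ _ _

theorem ncard_spectrum_monodromyMatrix_lt (he : 3 ≤ e) (hd : d ≠ 0) (h : e ∣ d) :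
    (spectrum ℂ (monodromyMatrix ℂ e d)).ncard < (e - 1) * (d - 1) := by
  have hed := Nat.le_of_dvd (Nat.pos_of_ne_zero hd) h
  have h_sin_row : Complex.sin (e * (Real.pi / e)) = 0 := by
    rw [mul_div_cancel₀ _ (Nat.cast_ne_zero.2 (by omega)), Complex.sin_pi]
  have h_sin_col : Complex.sin (d * (Real.pi / e)) = 0 := by
    obtain ⟨c, rfl⟩ := h
    rw [Nat.cast_mul, mul_comm (e : ℂ), mul_assoc,
      mul_div_cancel₀ _ (Nat.cast_ne_zero.2 (by omega)), Complex.sin_nat_mul_pi]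
  set z : VanCycle e d → ℂ := gridTensor (fun k => Complex.sin ((k : ℕ) * (Real.pi / e)))
    fun k => Complex.sin ((k : ℕ) * (Real.pi / e))
  have hp := rowEnd_gridTensor_sin h_sin_row fun k : Finset.Ico 1 d =>
    Complex.sin ((k : ℕ) * (Real.pi / e))
  have hq := colEnd_gridTensor_sin h_sin_col fun k : Finset.Ico 1 e =>
    Complex.sin ((k : ℕ) * (Real.pi / e))
  have h_one : (1 : ℕ) ∈ Finset.Ico 1 d := by simp; omega
  have h_ne {k : ℕ} (hk : k ∈ Finset.Ico 1 e) : z (⟨k, hk⟩, ⟨1, h_one⟩) ≠ 0 :=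
    mul_ne_zero (sin_natCast_mul_pi_div_ne_zero hk)
      (sin_natCast_mul_pi_div_ne_zero (by simp; omega))
  have h_indep := linearIndependent_of_gridVar_ker (2 * Complex.cos (Real.pi / e)) odd_one odd_one
    even_two odd_one (h_ne (k := 1) (by simp; omega)) (h_ne (k := 2) (by simp; omega))
  have fixed {v : VanCycle e d → ℂ} (hv : varEnd ℂ e d v = 0) :
      monodromyMatrix ℂ e d *ᵥ v = (1 : ℂ) • v := by
    rw [monodromyMatrix_mulVec, hv, add_zero, one_smul]
  have h_lt := ncard_spectrum_lt_card (fixed ((isGrid_end ℂ e d).gridVar_apply_sub hp hq))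
    (fixed ((isGrid_end ℂ e d).gridVar_apply_add hp hq)) h_indep
  simpa only [Fintype.card_prod, Fintype.card_coe, Nat.card_Ico] using h_lt

end Multiplicity

section Descent

lemma mem_span_range_intCast (K : Type*) {L ι n : Type*} [Field K] [CharZero K] [Field L]
    [CharZero L] [Finite ι] {u : ι → n → ℤ} {w : n → ℤ}
    (h : (fun x => (w x : L)) ∈ Submodule.span L (Set.range fun i x => (u i x : L))) :
    (fun x => (w x : K)) ∈ Submodule.span K (Set.range fun i x => (u i x : K)) := by
  have := Fintype.ofFinite ι
  rw [Submodule.mem_span_range_iff_exists_fun] at h ⊢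
  obtain ⟨c, hc⟩ := h
  obtain ⟨π, hπ⟩ := (Algebra.linearMap ℚ L).exists_leftInverse_of_injective
    (LinearMap.ker_eq_bot.2 (algebraMap ℚ L).injective)
  have π_intCast (m : ℤ) : π m = m := by simpa using LinearMap.congr_fun hπ (m : ℚ)
  have π_mul_intCast (a : L) (m : ℤ) : π (a * m) = π a * m := by
    rw [mul_comm, ← zsmul_eq_mul, map_zsmul, zsmul_eq_mul, mul_comm]
  refine ⟨fun i => (π (c i) : K), funext fun x => ?_⟩
  have h_rat := congrArg π (congrFun hc x)
  simp only [Finset.sum_apply, Pi.smul_apply, smul_eq_mul, map_sum, π_mul_intCast,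
    π_intCast] at h_rat
  simp only [Finset.sum_apply, Pi.smul_apply, smul_eq_mul]
  exact_mod_cast congrArg (Rat.cast : ℚ → K) h_rat

variable (K : Type*) [Field K] {e d : ℕ}

lemma cycleVec_eq_intCast (δ : VanCycle e d) :
    cycleVec K δ = fun x => (((Pi.single δ 1 : VanCycle e d → ℤ) x : ℤ) : K) := by
  ext x
  simp only [cycleVec, Pi.single_apply, Int.cast_ite, Int.cast_one, Int.cast_zero]

lemma monodromyMatrix_pow_mulVec_cycleVec (δ : VanCycle e d) (l : ℕ) :
    monodromyMatrix K e d ^ l *ᵥ cycleVec K δ =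
      fun x => ((((1 - intersectionMatrix e d) ^ l *ᵥ Pi.single δ 1) x : ℤ) : K) := by
  have h_map : monodromyMatrix K e d =
      (Int.castRingHom K).mapMatrix (1 - intersectionMatrix e d) := by
    rw [map_sub, map_one]
    rfl
  rw [h_map, ← map_pow, cycleVec_eq_intCast]
  exact funext fun x => ((Int.castRingHom K).map_mulVec _ _ x).symm

lemma Mon_eq_span_range (δ : VanCycle e d) :
    Mon K δ = Submodule.span K (Set.range fun (l : Fin ((e - 1) * (d - 1))) x =>
      ((((1 - intersectionMatrix e d) ^ (l : ℕ) *ᵥ Pi.single δ 1) x : ℤ) : K)) := by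
  rw [Mon]
  congr 1
  ext v
  simp only [← monodromyMatrix_pow_mulVec_cycleVec, Set.mem_range, Fin.exists_iff]
  constructor
  · rintro ⟨l, hl, rfl⟩
    exact ⟨l, hl, rfl⟩
  · rintro ⟨l, hl, rfl⟩
    exact ⟨l, hl, rfl⟩

theorem cycleVec_mem_Mon_of_complex [CharZero K] {δ δ' : VanCycle e d}
    (h : cycleVec ℂ δ' ∈ Mon ℂ δ) : cycleVec K δ' ∈ Mon K δ := by
  rw [Mon_eq_span_range, cycleVec_eq_intCast] at h ⊢
  exact mem_span_range_intCast K h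

end Descent

section Main

lemma exists_mul_iff_dvd {d r l : ℕ} (hr : r ∣ d) (h1 : 1 ≤ l) (hd : l < d) :
    (∃ n : ℕ, 1 ≤ n ∧ n ≤ d / r - 1 ∧ l = r * n) ↔ r ∣ l := by
  obtain ⟨c, rfl⟩ := hr
  constructor
  · rintro ⟨n, -, -, rfl⟩
    exact dvd_mul_right r n
  · rintro ⟨n, rfl⟩
    rw [Nat.mul_div_cancel_left _ (Nat.pos_of_mul_pos_right h1)]
    have hn₀ : 0 < n := Nat.pos_of_mul_pos_left h1
    have hn : n < c := lt_of_mul_lt_mul_left hd (Nat.zero_le r)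
    exact ⟨n, by omega, by omega, rfl⟩

variable (K : Type*) [Field K] [CharZero K]

theorem cycleVec_mem_Mon_iff {e d : ℕ} {δ δ' : VanCycle e d} (hδ : AdjClosed (Mon ℂ δ))
    (hrow : Nat.gcd e δ.row ∣ δ'.row) :
    cycleVec K δ' ∈ Mon K δ ↔
      ∃ n : ℕ, 1 ≤ n ∧ n ≤ d / Nat.gcd d δ.col - 1 ∧ δ'.col = Nat.gcd d δ.col * n := by
  have h_col : 1 ≤ δ'.col ∧ δ'.col < d := Finset.mem_Ico.1 δ'.2.2
  rw [exists_mul_iff_dvd (Nat.gcd_dvd_left d δ.col) h_col.1 h_col.2]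
  exact ⟨dvd_col_of_cycleVec_mem_Mon (Nat.gcd_dvd_left _ _) (Nat.gcd_dvd_right _ _), fun h_dvd =>
    cycleVec_mem_Mon_of_complex K (hδ.cycleVec_mem (cycleVec_mem_Mon δ) hrow h_dvd)⟩

lemma gcd_row_eq_one {e d : ℕ} (he : e.Prime) (δ : VanCycle e d) : Nat.gcd e δ.row = 1 := by
  have h := Finset.mem_Ico.1 δ.1.2
  exact Nat.coprime_of_lt_prime (Nat.one_le_iff_ne_zero.1 h.1) h.2 he

theorem mainTheorem7_general (d : ℕ) (hd : 1 ≤ d) :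
    (spectrum ℂ (monodromyMatrix ℂ 2 d) =
        {z : ℂ | ∃ j : ℕ, 1 ≤ j ∧ j ≤ d - 1 ∧
          z = 1 + 2 * Complex.I * ((Real.cos (j * Real.pi / d) : ℝ) : ℂ)} ∧
      ∀ δ δ' : VanCycle 2 d,
        cycleVec K δ' ∈ Mon K δ ↔
          ∃ n : ℕ, 1 ≤ n ∧ n ≤ d / Nat.gcd d δ.col - 1 ∧ δ'.col = Nat.gcd d δ.col * n) ∧
    (¬ 3 ∣ d → ∀ δ δ' : VanCycle 3 d,
        cycleVec K δ' ∈ Mon K δ ↔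
          ∃ n : ℕ, 1 ≤ n ∧ n ≤ d / Nat.gcd d δ.col - 1 ∧ δ'.col = Nat.gcd d δ.col * n) ∧
    (3 ∣ d → (spectrum ℂ (monodromyMatrix ℂ 3 d)).ncard < 2 * (d - 1)) ∧
    (¬ 4 ∣ d → ∀ δ δ' : VanCycle 4 d,
        ((δ.row = 1 ∨ δ.row = 3) →
          (cycleVec K δ' ∈ Mon K δ ↔
            ∃ n : ℕ, 1 ≤ n ∧ n ≤ d / Nat.gcd d δ.col - 1 ∧ δ'.col = Nat.gcd d δ.col * n)) ∧
        (δ.row = 2 →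
          (cycleVec K δ' ∈ Mon K δ ↔
            δ'.row = 2 ∧
              ∃ n : ℕ, 1 ≤ n ∧ n ≤ d / Nat.gcd d δ.col - 1 ∧
                δ'.col = Nat.gcd d δ.col * n))) ∧
    (4 ∣ d → (spectrum ℂ (monodromyMatrix ℂ 4 d)).ncard < 3 * (d - 1)) := by
  have hd₀ : d ≠ 0 := by omega
  refine ⟨⟨spectrum_monodromyMatrix_two d, fun δ δ' => ?_⟩, fun h3 δ δ' => ?_,
    ncard_spectrum_monodromyMatrix_lt le_rfl hd₀, fun h4 δ δ' => ⟨fun hδ => ?_, fun hδ => ?_⟩,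
    ncard_spectrum_monodromyMatrix_lt (by norm_num) hd₀⟩
  · refine cycleVec_mem_Mon_iff K (adjClosed_Mon_two δ) ?_
    simp [gcd_row_eq_one Nat.prime_two]
  · refine cycleVec_mem_Mon_iff K (adjClosed_Mon_three h3 δ) ?_
    simp [gcd_row_eq_one Nat.prime_three]
  · refine cycleVec_mem_Mon_iff K (adjClosed_Mon_four h4 δ) ?_
    rcases hδ with h | h <;> simp [h]
  · have iff_col (h : δ'.row = 2) := cycleVec_mem_Mon_iff K (δ' := δ') (adjClosed_Mon_four h4 δ)
      (by simp [hδ, h])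
    have row_eq_two (h : cycleVec K δ' ∈ Mon K δ) : δ'.row = 2 := by
      have h_dvd : 2 ∣ δ'.row := dvd_row_of_cycleVec_mem_Mon (by norm_num) hδ.symm.dvd h
      have h_lt : δ'.row ∈ Finset.Ico 1 4 := δ'.1.2
      grind
    exact ⟨fun h => ⟨row_eq_two h, (iff_col (row_eq_two h)).1 h⟩,
      fun ⟨h_row, h⟩ => (iff_col h_row).2 h⟩

end Main

theorem mainTheorem7 (K : Type*) [Field K] [CharZero K] (d : ℕ) (hd : 1 ≤ d) :
    -- `y^2 + x^d`, every degree `d`: the eigenvalues of `M_2`, and the cycles in `Mon(δ_1^j)`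
    (spectrum ℂ (monodromyMatrix ℂ 2 d) =
        {z : ℂ | ∃ j : ℕ, 1 ≤ j ∧ j ≤ d - 1 ∧
          z = 1 + 2 * Complex.I * ((Real.cos (j * Real.pi / d) : ℝ) : ℂ)} ∧
      ∀ δ δ' : VanCycle 2 d,
        cycleVec K δ' ∈ Mon K δ ↔
          ∃ n : ℕ, 1 ≤ n ∧ n ≤ d / Nat.gcd d δ.col - 1 ∧ δ'.col = Nat.gcd d δ.col * n) ∧
    -- `y^3 + x^d`
    (d ≤ 100 → ¬ 3 ∣ d → ∀ δ δ' : VanCycle 3 d,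
        cycleVec K δ' ∈ Mon K δ ↔
          ∃ n : ℕ, 1 ≤ n ∧ n ≤ d / Nat.gcd d δ.col - 1 ∧ δ'.col = Nat.gcd d δ.col * n) ∧
    (3 ∣ d → (spectrum ℂ (monodromyMatrix ℂ 3 d)).ncard < 2 * (d - 1)) ∧
    -- `y^4 + x^d`
    (d ≤ 100 → ¬ 4 ∣ d → ∀ δ δ' : VanCycle 4 d,
        ((δ.row = 1 ∨ δ.row = 3) →
          (cycleVec K δ' ∈ Mon K δ ↔
            ∃ n : ℕ, 1 ≤ n ∧ n ≤ d / Nat.gcd d δ.col - 1 ∧ δ'.col = Nat.gcd d δ.col * n)) ∧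
        (δ.row = 2 →
          (cycleVec K δ' ∈ Mon K δ ↔
            δ'.row = 2 ∧
              ∃ n : ℕ, 1 ≤ n ∧ n ≤ d / Nat.gcd d δ.col - 1 ∧
                δ'.col = Nat.gcd d δ.col * n))) ∧
    (4 ∣ d → (spectrum ℂ (monodromyMatrix ℂ 4 d)).ncard < 3 * (d - 1)) := by
  obtain ⟨h2, h3, h3_dvd, h4, h4_dvd⟩ := mainTheorem7_general K d hd
  exact ⟨h2, fun _ => h3, h3_dvd, fun _ => h4, h4_dvd⟩
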